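/- Consider the following optimization problem. The input is a finite undirected or directed graph $G=(V,E)$ (parallel edges and loops allowed), two terminals $s,t\in V$, and two vectors $a,c\in\mathbb{Q}^{E}$ with $a,c\ge 0$. Let $\mathcal{P}_{s,t}(G)$ be the set of (edge sets of) simple $s$-$t$-paths in $G$, directed ones if $G$ is directed. The task $\mathrm{COPIC}(\mathcal{P}_{s,t}(G),\mathcal{P}_{s,t}(G),\operatorname{diag}(a),c,c)$ is to find $S_1,S_2\in\mathcal{P}_{s,t}(G)$ that minimize $$f(S_1,S_2)=\sum_{i\in S_1}\sum_{j\in S_2}q_{ij}+\sum_{i\in S_1}c_i+\sum_{j\in S_2}c_j ,\qquad (q_{ij})=\operatorname{diag}(a),$$ (that is, $f(S_1,S_2)=\sum_{e\in S_1\cap S_2}a_e+\sum_{e\in S_1}c_e+\sum_{e\in S_2}c_e$), or to report that $\mathcal{P}_{s,t}(G)=\emptyset$. Theorem. For undirected graphs as well as for directed graphs, this problem is solvable in polynomial time: there exist a program for the random access machine with operations $+,-,\times$ and logarithmic cost (a machine model that is polynomially equivalent to Turing machines) and a polynomial $p$ such that on every input of bit length $L$ the program halts with a correct answer at cost at most $p(L)$.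 The input lists the vertices and the edges, all numbers are written in binary, and each rational cost is given by its numerator and denominator. -/

import Mathlib

/-! ### Random access machines with logarithmic cost

The machine model is the random access machine with the logarithmic cost criterion, programmed in
structured form (sequence, conditional, loop). Memory cells hold integers, indirect addressing is
allowed, the arithmetic operations are `+`, `-`, `*`, and every operation is charged the bit
lengths of all addresses and operands that it touches. -/

namespace RAM

/-- Bit length of an integer, sign included; it is at least one. -/
def bitLength (z : ℤ) : ℕ := Nat.size z.natAbs + 1

/-- The memory contents. -/
abbrev Store : Type := ℤ → ℤ

/-- Integer expressions of the programming language. -/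
inductive Expr : Type
  | const (z : ℤ)
  | load (addr : Expr)
  | add (e f : Expr)
  | sub (e f : Expr)
  | mul (e f : Expr)

/-- The value of an expression. -/
def Expr.eval (σ : Store) : Expr → ℤ
  | .const z => z
  | .load addr => σ (addr.eval σ)
  | .add e f => e.eval σ + f.eval σ
  | .sub e f => e.eval σ - f.eval σ
  | .mul e f => e.eval σ * f.eval σ

/-- The logarithmic cost of evaluating an expression. -/
def Expr.cost (σ : Store) : Expr → ℕ
  | .const z => bitLength z
  | .load addr => addr.cost σ + bitLength (addr.eval σ) + bitLength (σ (addr.eval σ))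
  | .add e f => e.cost σ + f.cost σ + bitLength (e.eval σ) + bitLength (f.eval σ)
  | .sub e f => e.cost σ + f.cost σ + bitLength (e.eval σ) + bitLength (f.eval σ)
  | .mul e f => e.cost σ + f.cost σ + bitLength (e.eval σ) + bitLength (f.eval σ)

/-- Programs. Conditionals and loops test whether an expression is positive. -/
inductive Program : Type
  | skip
  | store (addr val : Expr)
  | seq (p q : Program)
  | ifPos (e : Expr) (p q : Program)
  | whilePos (e : Expr) (p : Program)

/-- `Runs p σ t τ`: the program `p`, started with memory contents `σ`, halts with memory
contents `τ`, and the total cost of this computation is `t`. -/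
inductive Runs : Program → Store → ℕ → Store → Prop
  | skip (σ : Store) : Runs .skip σ 1 σ
  | store (addr val : Expr) (σ : Store) :
      Runs (.store addr val) σ
        (addr.cost σ + val.cost σ + bitLength (addr.eval σ) + bitLength (val.eval σ))
        (Function.update σ (addr.eval σ) (val.eval σ))
  | seq {p q : Program} {σ τ ρ : Store} {t u : ℕ} :
      Runs p σ t τ → Runs q τ u ρ → Runs (.seq p q) σ (t + u) ρ
  | ifTrue {e : Expr} {p q : Program} {σ τ : Store} {t : ℕ} :
      0 < e.eval σ → Runs p σ t τ →
      Runs (.ifPos e p q) σ (e.cost σ + bitLength (e.eval σ) + t) τ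
  | ifFalse {e : Expr} {p q : Program} {σ τ : Store} {t : ℕ} :
      ¬ 0 < e.eval σ → Runs q σ t τ →
      Runs (.ifPos e p q) σ (e.cost σ + bitLength (e.eval σ) + t) τ
  | whileTrue {e : Expr} {p : Program} {σ τ ρ : Store} {t u : ℕ} :
      0 < e.eval σ → Runs p σ t τ → Runs (.whilePos e p) τ u ρ →
      Runs (.whilePos e p) σ (e.cost σ + bitLength (e.eval σ) + t + u) ρ
  | whileFalse {e : Expr} {p : Program} {σ : Store} :
      ¬ 0 < e.eval σ → Runs (.whilePos e p) σ (e.cost σ + bitLength (e.eval σ)) σ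

/-- The machine is deterministic: final memory and cost are determined by the initial memory. -/
theorem Runs.deterministic {p : Program} {σ τ τ' : Store} {t t' : ℕ}
    (h : Runs p σ t τ) (h' : Runs p σ t' τ') : t = t' ∧ τ = τ' := by
  induction h generalizing t' τ' with
  | skip => cases h'; exact ⟨rfl, rfl⟩
  | store => cases h'; exact ⟨rfl, rfl⟩
  | seq _ _ ih₁ ih₂ =>
    cases h' with
    | seq k₁ k₂ =>
      obtain ⟨rfl, rfl⟩ := ih₁ k₁
      obtain ⟨rfl, rfl⟩ := ih₂ k₂
      exact ⟨rfl, rfl⟩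
  | ifTrue h _ ih =>
    cases h' with
    | ifTrue _ k => obtain ⟨rfl, rfl⟩ := ih k; exact ⟨rfl, rfl⟩
    | ifFalse k _ => exact absurd h k
  | ifFalse h _ ih =>
    cases h' with
    | ifTrue k _ => exact absurd k h
    | ifFalse _ k => obtain ⟨rfl, rfl⟩ := ih k; exact ⟨rfl, rfl⟩
  | whileTrue h _ _ ih₁ ih₂ =>
    cases h' with
    | whileTrue _ k₁ k₂ =>
      obtain ⟨rfl, rfl⟩ := ih₁ k₁
      obtain ⟨rfl, rfl⟩ := ih₂ k₂
      exact ⟨rfl, rfl⟩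
    | whileFalse k => exact absurd h k
  | whileFalse h =>
    cases h' with
    | whileTrue k _ _ => exact absurd k h
    | whileFalse _ => exact ⟨rfl, rfl⟩

/-- The memory holding the word `w`: its length is in cell `0`, its entries are in the cells
`1, 2, …, w.length`, and all other cells are `0`. -/
def inputStore (w : List ℤ) : Store := fun i =>
  if i = 0 then (w.length : ℤ) else if 0 < i then w.getD (i.toNat - 1) 0 else 0

/-- The word `w` is written in the memory `σ` in the same format; other cells are arbitrary. -/
def IsOutput (σ : Store) (w : List ℤ) : Prop :=
  σ 0 = (w.length : ℤ) ∧ ∀ i : Fin w.length, σ ((i : ℕ) + 1 : ℤ) = w.get i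

/-- Total bit length of a word. -/
def inputLength (w : List ℤ) : ℕ := (w.map bitLength).sum

/-- A search problem, with instances `x : ι` given to the machine as `encIn x`, and for which
`y` is a correct answer to `x` if `Correct x y`, is solvable in polynomial time on the instances
in `valid`: a single program halts on every valid instance with an encoding of a correct answer,
at a cost bounded by a polynomial in the bit length of the encoded instance. -/
def SolvableInPolyTime {ι : Type} {α : ι → Type} (encIn : ι → List ℤ)
    (encOut : (x : ι) → α x → List ℤ) (Correct : (x : ι) → α x → Prop) (valid : Set ι) : Prop :=
  ∃ (P : Program) (b : Polynomial ℕ), ∀ x ∈ valid, ∃ (t : ℕ) (σ : Store) (y : α x),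
    Runs P (inputStore (encIn x)) t σ ∧ t ≤ b.eval (inputLength (encIn x)) ∧
    IsOutput σ (encOut x y) ∧ Correct x y

end RAM

/-! ### Combinatorial optimization with interaction costs -/

namespace COPIC

/-- The objective function of COPIC. -/
def objective {m n : ℕ} (Q : Matrix (Fin m) (Fin n) ℚ) (c : Fin m → ℚ) (d : Fin n → ℚ)
    (S₁ : Finset (Fin m)) (S₂ : Finset (Fin n)) : ℚ :=
  (∑ i ∈ S₁, ∑ j ∈ S₂, Q i j) + (∑ i ∈ S₁, c i) + (∑ j ∈ S₂, d j)

/-- `y` is a correct answer to `COPIC(F₁, F₂, Q, c, d)`: a pair of feasible sets minimizing the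
objective function, or `none` if there is no feasible pair. -/
def IsAnswer {m n : ℕ} (F₁ : Set (Finset (Fin m))) (F₂ : Set (Finset (Fin n)))
    (Q : Matrix (Fin m) (Fin n) ℚ) (c : Fin m → ℚ) (d : Fin n → ℚ) :
    Option (Finset (Fin m) × Finset (Fin n)) → Prop
  | none => F₁ = ∅ ∨ F₂ = ∅
  | some (S₁, S₂) => S₁ ∈ F₁ ∧ S₂ ∈ F₂ ∧
      ∀ T₁ ∈ F₁, ∀ T₂ ∈ F₂, objective Q c d S₁ S₂ ≤ objective Q c d T₁ T₂

/-- A finite graph or digraph on the vertices `0, …, n - 1` with edges (arcs) `0, …, m - 1`,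
parallel edges and loops allowed, with two terminals and two cost vectors on the edges.
For a digraph, `ends e` is the tail and the head of the arc `e`; for a graph, it is the two
ends of the edge `e` in any order. -/
structure PathInstance : Type where
  n : ℕ
  m : ℕ
  ends : Fin m → Fin n × Fin n
  s : Fin n
  t : Fin n
  a : Fin m → ℚ
  c : Fin m → ℚ

/-- In a digraph, the arc `e` can be traversed from `u` to `v`. -/
def PathInstance.diLink (I : PathInstance) (e : Fin I.m) (u v : Fin I.n) : Prop :=
  I.ends e = (u, v)

/-- In an undirected graph, the edge `e` can be traversed from `u` to `v`. -/
def PathInstance.link (I : PathInstance) (e : Fin I.m) (u v : Fin I.n) : Prop :=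
  I.ends e = (u, v) ∨ I.ends e = (v, u)

/-- The list `[(e₁, v₁), …, (eₖ, vₖ)]` is a walk from `u` to `v`: the edge `e₁` leads from `u`
to `v₁`, the edge `eᵢ₊₁` leads from `vᵢ` to `vᵢ₊₁`, and the walk ends in `v`. -/
def IsWalk {V E : Type} (L : E → V → V → Prop) : V → List (E × V) → V → Prop
  | u, [], v => u = v
  | u, (e, w) :: p, v => L e u w ∧ IsWalk L w p v

/-- The edge sets of the `s`-`t`-paths, that is, of the walks from `s` to `t` without repeated
vertices. -/
def paths {V E : Type} [DecidableEq E] (L : E → V → V → Prop) (s t : V) : Set (Finset E) :=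
  {S | ∃ p : List (E × V), IsWalk L s p t ∧ (s :: p.map Prod.snd).Nodup ∧
    S = (p.map Prod.fst).toFinset}

/-- The instance as a word of integers: numbers of vertices and edges, terminals, vertex list,
and for each edge its two ends and its costs as numerators and denominators in lowest terms. -/
def PathInstance.encode (I : PathInstance) : List ℤ :=
  [(I.n : ℤ), (I.m : ℤ), (I.s : ℤ), (I.t : ℤ)] ++
  (List.finRange I.n).map (fun v : Fin I.n => ((v : ℕ) : ℤ)) ++
  (List.finRange I.m).flatMap (fun e : Fin I.m =>
    [((I.ends e).1 : ℤ), ((I.ends e).2 : ℤ),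
      (I.a e).num, ((I.a e).den : ℤ), (I.c e).num, ((I.c e).den : ℤ)])

/-- A subset of `{0, …, m - 1}` as a `0`-`1`-vector. -/
def indicatorWord {m : ℕ} (S : Finset (Fin m)) : List ℤ :=
  (List.finRange m).map (fun e : Fin m => if e ∈ S then 1 else 0)

/-- An answer as a word of integers: `0` for infeasible, and `1` followed by the indicator
vectors of the two sets otherwise. -/
def encodeAnswer {m n : ℕ} : Option (Finset (Fin m) × Finset (Fin n)) → List ℤ
  | none => [0]
  | some (S₁, S₂) => 1 :: (indicatorWord S₁ ++ indicatorWord S₂)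

end COPIC

/-! Two $s$-$t$-paths add up to an integral flow of value two. Charge an edge carrying $z$ units the
amount $c|z|$, plus $a$ if $|z|=2$; this is convex on $\{-2,\dots,2\}$ because $a,c\ge 0$. The sum
of the unit flows of two paths costs at most as much as the pair, since opposite traversals cancel
and cancelling only saves (`exists_flow_le_pairCost`). Conversely, an integral flow of value two
contains two simple paths and a remaining circulation, and dropping the circulation does not
increase the cost (`run_extract`, `pairCost_le`). So the task is a minimum cost flow problem with
convex costs. Digraphs use flows in $[0,2]$, undirected graphs flows in $[-2,2]$; the parameter `lo`
is the only difference between the two algorithms.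

The flow is found by two successive shortest path augmentations. Vertex potentials certify
optimality: on each edge the potential difference is a subgradient of the edge cost (`IsTight`), and
summing the subgradient inequalities against the circulation $h-F$ gives optimality
(`sum_edgeCost_le`). Dijkstra's search adjusts the potentials until the path found has reduced
length zero (`IsTree.step`, `run_search`), and augmenting along such a path keeps the certificate
(`IsTight.augment`). If $t$ is not reached in either stage, there is no path at all, because a flow
with $|F|\le 1$ leaves every edge usable.

For the running time, the algorithm is written in a small array language. Its loops run a constant
times $n$ or $m$ rounds, and it multiplies only by constants or input entries. Hence each step adds
a bounded number of bits, and a weight polynomial can be read off from the syntax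
(`Cmd.runsWithin`). Rational costs become integers by multiplying with the product of all
denominators, which has polynomial bit length. `solvableInPolyTime_of_cmd` moves the result to the
machine. -/

namespace RAM

/-! ### Bit lengths -/

theorem one_le_bitLength (z : ℤ) : 1 ≤ bitLength z := by simp [bitLength]

theorem bitLength_neg (z : ℤ) : bitLength (-z) = bitLength z := by simp [bitLength]

theorem bitLength_add_le (x y : ℤ) : bitLength (x + y) ≤ max (bitLength x) (bitLength y) + 1 := by
  unfold bitLength
  have hx := Nat.lt_size_self x.natAbs
  have hy := Nat.lt_size_self y.natAbs
  have h := Int.natAbs_add_le x y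
  set a := Nat.size x.natAbs
  set b := Nat.size y.natAbs
  have ha : 2 ^ a ≤ 2 ^ max a b := Nat.pow_le_pow_right (by norm_num) (le_max_left _ _)
  have hb : 2 ^ b ≤ 2 ^ max a b := Nat.pow_le_pow_right (by norm_num) (le_max_right _ _)
  have : Nat.size (x + y).natAbs ≤ max a b + 1 := by
    rw [Nat.size_le, pow_succ]
    omega
  omega

theorem bitLength_sub_le (x y : ℤ) : bitLength (x - y) ≤ max (bitLength x) (bitLength y) + 1 := by
  rw [sub_eq_add_neg, ← bitLength_neg y]
  exact bitLength_add_le _ _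

theorem bitLength_mul_le (x y : ℤ) : bitLength (x * y) ≤ bitLength x + bitLength y := by
  unfold bitLength
  have hx := Nat.lt_size_self x.natAbs
  have hy := Nat.lt_size_self y.natAbs
  have : Nat.size (x * y).natAbs ≤ Nat.size x.natAbs + Nat.size y.natAbs := by
    rw [Nat.size_le, pow_add, Int.natAbs_mul]
    exact Nat.mul_lt_mul'' hx hy
  omega

theorem bitLength_natCast_le (n : ℕ) : bitLength (n : ℤ) ≤ n + 1 := by
  have : Nat.size n ≤ n := Nat.size_le.2 Nat.lt_two_pow_self
  simpa [bitLength] using this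

/-! ### Costs in terms of a weight

A computation of weight `w` started in a memory whose cells have at most `K` bits costs at most
`w * (K + w)`, and leaves a memory whose cells have at most `K + w` bits. -/

/-- All memory cells have at most `K` bits. -/
def Bits (K : ℕ) (σ : Store) : Prop := ∀ i, bitLength (σ i) ≤ K

theorem Bits.mono {K K' : ℕ} {σ : Store} (h : Bits K σ) (hK : K ≤ K') : Bits K' σ :=
  fun i => (h i).trans hK

/-- The expression `e` has weight at most `w` in the memory `σ` with cells of `K` bits. -/
def Expr.Within (e : Expr) (σ : Store) (K w : ℕ) : Prop :=
  e.cost σ ≤ w * (K + w) ∧ bitLength (e.eval σ) ≤ K + w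

/-- The program `p` takes `σ` to `τ` with weight at most `w`, where cells of `σ` have `K` bits. -/
def RunsWithin (p : Program) (σ : Store) (K w : ℕ) (τ : Store) : Prop :=
  ∃ t, Runs p σ t τ ∧ t ≤ w * (K + w) ∧ Bits (K + w) τ

theorem Expr.Within.const (z : ℤ) (σ : Store) (K : ℕ) :
    (Expr.const z).Within σ K (bitLength z) := by
  refine ⟨?_, ?_⟩
  · simp only [Expr.cost]
    have := one_le_bitLength z
    nlinarith [Nat.zero_le (bitLength z * K)]
  · simp [Expr.eval]

theorem Expr.Within.load {e : Expr} {σ : Store} {K w : ℕ} (h : e.Within σ K w) (hσ : Bits K σ) :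
    (Expr.load e).Within σ K (w + 2) := by
  obtain ⟨h1, h2⟩ := h
  have h3 := hσ (e.eval σ)
  refine ⟨?_, ?_⟩
  · simp only [Expr.cost]
    nlinarith
  · simp only [Expr.eval]
    omega

theorem weight_add_le {a b K : ℕ} :
    a * (K + a) + b * (K + b) + (K + a) + (K + b) ≤ (a + b + 2) * (K + (a + b + 2)) := by
  nlinarith [Nat.zero_le (a * b)]

theorem Expr.Within.add {e f : Expr} {σ : Store} {K w u : ℕ} (h : e.Within σ K w)
    (k : f.Within σ K u) : (Expr.add e f).Within σ K (w + u + 2) := by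
  have := bitLength_add_le (e.eval σ) (f.eval σ)
  have := @weight_add_le w u K
  obtain ⟨h1, h2⟩ := h
  obtain ⟨k1, k2⟩ := k
  exact ⟨by simp only [Expr.cost]; omega, by simp only [Expr.eval]; omega⟩

theorem Expr.Within.sub {e f : Expr} {σ : Store} {K w u : ℕ} (h : e.Within σ K w)
    (k : f.Within σ K u) : (Expr.sub e f).Within σ K (w + u + 2) := by
  have := bitLength_sub_le (e.eval σ) (f.eval σ)
  have := @weight_add_le w u K
  obtain ⟨h1, h2⟩ := h
  obtain ⟨k1, k2⟩ := k
  exact ⟨by simp only [Expr.cost]; omega, by simp only [Expr.eval]; omega⟩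

/-- The a priori bound `B` on the left factor is what keeps weights additive: a product of two
arbitrary cells could double the bit length, and iterating that would be exponential. -/
theorem Expr.Within.mul {e f : Expr} {σ : Store} {K w u B : ℕ} (h : e.Within σ K w)
    (hB : bitLength (e.eval σ) ≤ B) (k : f.Within σ K u) :
    (Expr.mul e f).Within σ K (w + u + 2 + B) := by
  have := bitLength_mul_le (e.eval σ) (f.eval σ)
  have h3 := @weight_add_le w u K
  obtain ⟨h1, h2⟩ := h
  obtain ⟨k1, k2⟩ := k
  refine ⟨?_, by simp only [Expr.eval]; omega⟩
  have : (w + u + 2) * (K + (w + u + 2)) ≤ (w + u + 2 + B) * (K + (w + u + 2 + B)) :=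
    Nat.mul_le_mul (by omega) (by omega)
  simp only [Expr.cost]
  omega

theorem RunsWithin.mono {p : Program} {σ τ : Store} {K w u : ℕ} (h : RunsWithin p σ K w τ)
    (hw : w ≤ u) : RunsWithin p σ K u τ := by
  obtain ⟨t, h1, h2, h3⟩ := h
  exact ⟨t, h1, h2.trans (Nat.mul_le_mul hw (by omega)), h3.mono (by omega)⟩

theorem RunsWithin.skip {σ : Store} {K : ℕ} (hσ : Bits K σ) :
    RunsWithin .skip σ K 1 σ :=
  ⟨1, .skip σ, by omega, hσ.mono (by omega)⟩

theorem RunsWithin.store {a v : Expr} {σ : Store} {K w u : ℕ} (hσ : Bits K σ)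
    (ha : a.Within σ K w) (hv : v.Within σ K u) :
    RunsWithin (.store a v) σ K (w + u + 2)
      (Function.update σ (a.eval σ) (v.eval σ)) := by
  refine ⟨_, .store a v σ, ?_, ?_⟩
  · have := @weight_add_le w u K
    have := ha.1; have := ha.2; have := hv.1; have := hv.2
    omega
  · intro i
    rw [Function.update_apply]
    split_ifs
    · exact hv.2.trans (by omega)
    · exact (hσ i).trans (by omega)

/-- The second program starts with cells of `K + w` bits, and $w(K+w)+u(K+w+u)\le (w+u)(K+w+u)$. The
form $w(K+w)$ of the bound is chosen so that weights simply add under composition. -/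
theorem RunsWithin.seq {p q : Program} {σ τ ρ : Store} {K w u : ℕ} (h : RunsWithin p σ K w τ)
    (k : RunsWithin q τ (K + w) u ρ) : RunsWithin (.seq p q) σ K (w + u) ρ := by
  obtain ⟨t, h1, h2, h3⟩ := h
  obtain ⟨t', k1, k2, k3⟩ := k
  refine ⟨_, .seq h1 k1, ?_, by rwa [← add_assoc]⟩
  nlinarith [Nat.zero_le (w * u)]

theorem weight_test_le {t c b w v K : ℕ} (h : c ≤ w * (K + w)) (h' : b ≤ K + w)
    (h2 : t ≤ v * (K + v)) : c + b + t ≤ (w + 1 + v) * (K + (w + 1 + v)) := by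
  nlinarith [Nat.zero_le (w * v)]

theorem RunsWithin.ifTrue {e : Expr} {p q : Program} {σ τ : Store} {K w u : ℕ}
    (he : e.Within σ K w) (hpos : 0 < e.eval σ) (h : RunsWithin p σ K u τ) :
    RunsWithin (.ifPos e p q) σ K (w + 1 + u) τ := by
  obtain ⟨t, h1, h2, h3⟩ := h
  exact ⟨_, .ifTrue hpos h1, weight_test_le he.1 he.2 h2, h3.mono (by omega)⟩

theorem RunsWithin.ifFalse {e : Expr} {p q : Program} {σ τ : Store} {K w u : ℕ}
    (he : e.Within σ K w) (hpos : ¬ 0 < e.eval σ) (h : RunsWithin q σ K u τ) :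
    RunsWithin (.ifPos e p q) σ K (w + 1 + u) τ := by
  obtain ⟨t, h1, h2, h3⟩ := h
  exact ⟨_, .ifFalse hpos h1, weight_test_le he.1 he.2 h2, h3.mono (by omega)⟩

theorem RunsWithin.whileFalse {e : Expr} {p : Program} {σ : Store} {K w : ℕ} (hσ : Bits K σ)
    (he : e.Within σ K w) (hpos : ¬ 0 < e.eval σ) :
    RunsWithin (.whilePos e p) σ K (w + 1) σ := by
  refine ⟨_, .whileFalse hpos, ?_, hσ.mono (by omega)⟩
  have := weight_test_le (t := 0) (v := 0) he.1 he.2 (by omega)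
  simpa using this

theorem RunsWithin.whileTrue {e : Expr} {p : Program} {σ τ ρ : Store} {K w u v : ℕ}
    (he : e.Within σ K w) (hpos : 0 < e.eval σ) (h : RunsWithin p σ K u τ)
    (k : RunsWithin (.whilePos e p) τ (K + (w + 1 + u)) v ρ) :
    RunsWithin (.whilePos e p) σ K (w + 1 + u + v) ρ := by
  obtain ⟨t, h1, h2, h3⟩ := h
  obtain ⟨t', k1, k2, k3⟩ := k
  refine ⟨_, .whileTrue hpos h1 k1, ?_, by rwa [← add_assoc]⟩
  have := weight_test_le he.1 he.2 h2
  generalize w + 1 + u = W at *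
  nlinarith [Nat.zero_le (W * v)]

/-- A loop with an invariant: in round `i` the memory satisfies `I i`, and the test fails in round
`n` for the first time. -/
theorem RunsWithin.while_invariant {e : Expr} {p : Program} (I : ℕ → Store → Prop) {n w u : ℕ}
    (hexpr : ∀ i ≤ n, ∀ K σ, Bits K σ → I i σ → e.Within σ K w)
    (hpos : ∀ i < n, ∀ σ, I i σ → 0 < e.eval σ) (hneg : ∀ σ, I n σ → ¬ 0 < e.eval σ)
    (hbody : ∀ i < n, ∀ K σ, Bits K σ → I i σ →
      ∃ τ, RunsWithin p σ K u τ ∧ I (i + 1) τ)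
    {K : ℕ} {σ : Store} (hσ : Bits K σ) (h0 : I 0 σ) :
    ∃ τ, RunsWithin (.whilePos e p) σ K (n * (w + 1 + u) + (w + 1)) τ ∧ I n τ := by
  -- Induction on the number `j` of remaining rounds. The bit bound `K` must be generalized, since
  -- it grows in every round.
  suffices H : ∀ j i, i + j = n → ∀ K σ, Bits K σ → I i σ →
      ∃ τ, RunsWithin (.whilePos e p) σ K (j * (w + 1 + u) + (w + 1)) τ ∧ I n τ from
    H n 0 (by omega) K σ hσ h0
  intro j
  induction j with
  | zero =>
    intro i hi K σ hσ h
    obtain rfl : i = n := by omega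
    exact ⟨σ, by simpa using RunsWithin.whileFalse hσ (hexpr _ le_rfl K σ hσ h) (hneg σ h), h⟩
  | succ j ih =>
    intro i hi K σ hσ h
    obtain ⟨τ, h1, h2⟩ := hbody i (by omega) K σ hσ h
    have h3 : Bits (K + (w + 1 + u)) τ := by
      obtain ⟨_, _, _, h⟩ := h1
      exact h.mono (by omega)
    obtain ⟨ρ, k1, k2⟩ := ih (i + 1) (by omega) _ τ h3 h2
    refine ⟨ρ, ?_, k2⟩
    have := RunsWithin.whileTrue (hexpr i (by omega) K σ hσ h) (hpos i (by omega) σ h) h1 k1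
    exact this.mono (by rw [Nat.succ_mul]; omega)

/-! ### A language with arrays and bounded loops -/

/-- The contents of fourteen arrays of integers. -/
abbrev Arrays : Type := Fin 14 → ℤ → ℤ

/-- Expressions: `ctr d` is the counter of the `d`-th enclosing loop, `inp` reads the input word,
`arr k` reads the array `k`; products are allowed with a constant or an entry of the input. -/
inductive Ex : Type
  | const (z : ℤ)
  | ctr (d : ℕ)
  | inp (i : Ex)
  | arr (k : Fin 14) (i : Ex)
  | add (e f : Ex)
  | sub (e f : Ex)
  | scale (z : ℤ) (e : Ex)
  | mulInp (i e : Ex)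

/-- The value of an expression. -/
def Ex.eval (P : ℤ → ℤ) (env : ℕ → ℤ) (S : Arrays) : Ex → ℤ
  | .const z => z
  | .ctr d => env d
  | .inp i => P (i.eval P env S)
  | .arr k i => S k (i.eval P env S)
  | .add e f => e.eval P env S + f.eval P env S
  | .sub e f => e.eval P env S - f.eval P env S
  | .scale z e => z * e.eval P env S
  | .mulInp i e => P (i.eval P env S) * e.eval P env S

/-- Commands. The number of rounds of `loop c b p` is `c` times the first (if `b = false`) or the
second (if `b = true`) entry of the input. -/
inductive Cmd : Type
  | skip
  | set (k : Fin 14) (i v : Ex)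
  | seq (p q : Cmd)
  | ite (e : Ex) (p q : Cmd)
  | loop (c : ℕ) (b : Bool) (p : Cmd)

/-- Change one entry of one array. -/
def Arrays.set (S : Arrays) (k : Fin 14) (i x : ℤ) : Arrays :=
  fun k' i' => if k' = k ∧ i' = i then x else S k' i'

/-- Branch on the sign of a number. -/
def ifPos (z : ℤ) (S T : Arrays) : Arrays := if 0 < z then S else T

/-- The effect of a command inside of `d` loops whose counters are given by `env`. -/
def Cmd.run (P : ℤ → ℤ) : Cmd → ℕ → (ℕ → ℤ) → Arrays → Arrays
  | .skip, _, _, S => S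
  | .set k i v, _, env, S => S.set k (i.eval P env S) (v.eval P env S)
  | .seq p q, d, env, S => q.run P d env (p.run P d env S)
  | .ite e p q, d, env, S => ifPos (e.eval P env S) (p.run P d env S) (q.run P d env S)
  | .loop c b p, d, env, S =>
      Nat.rec S (fun i T => p.run P (d + 1) (Function.update env d (i : ℤ)) T)
        (c * (P (cond b 2 1)).toNat)

/-- Loops with an invariant. -/
theorem Cmd.loop_invariant {P : ℤ → ℤ} {c : ℕ} {b : Bool} {p : Cmd} {d : ℕ} {env : ℕ → ℤ}
    (I : ℕ → Arrays → Prop) {S : Arrays} {n : ℕ} (hn : c * (P (cond b 2 1)).toNat = n)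
    (h0 : I 0 S)
    (h : ∀ i < n, ∀ T, I i T → I (i + 1) (p.run P (d + 1) (Function.update env d (i : ℤ)) T)) :
    I n ((Cmd.loop c b p).run P d env S) := by
  simp only [Cmd.run, hn]
  have : ∀ j ≤ n, I j (Nat.rec S
      (fun i T => p.run P (d + 1) (Function.update env d (i : ℤ)) T) j) := by
    intro j
    induction j with
    | zero => intro _; exact h0
    | succ j ih => intro hj; exact h j (by omega) _ (ih (by omega))
  exact this n le_rfl

/-! ### Compilation -/

/-- Compilation of expressions: entry `i` of the input is in cell `-16 i`, loop counters are in the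
cells `-16 d - 1`, entry `i` of the array `k` is in cell `-16 i - 2 - k`. -/
def Ex.compile (d : ℕ) : Ex → Expr
  | .const z => .const z
  | .ctr i => if i < d then .load (.const (-16 * (i : ℤ) - 1)) else .const 0
  | .inp i => .load (.mul (.const (-16)) (i.compile d))
  | .arr k i => .load (.sub (.mul (.const (-16)) (i.compile d)) (.const (2 + (k : ℕ))))
  | .add e f => .add (e.compile d) (f.compile d)
  | .sub e f => .sub (e.compile d) (f.compile d)
  | .scale z e => .mul (.const z) (e.compile d)
  | .mulInp i e => .mul (.load (.mul (.const (-16)) (i.compile d))) (e.compile d)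

open Polynomial in
/-- A weight of the compiled expression. -/
noncomputable def Ex.weight : Ex → ℕ[X]
  | .const z => C (bitLength z)
  | .ctr i => C (bitLength (-16 * (i : ℤ) - 1) + 2)
  | .inp i => C (2 * bitLength (-16) + 4) + i.weight
  | .arr k i => C (2 * bitLength (-16) + bitLength (2 + ((k : ℕ) : ℤ)) + 6) + i.weight
  | .add e f => e.weight + f.weight + 2
  | .sub e f => e.weight + f.weight + 2
  | .scale z e => C (2 * bitLength z + 2) + e.weight
  | .mulInp i e => C (2 * bitLength (-16) + 6) + i.weight + e.weight + X

/-- Compilation of commands. -/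
def Cmd.compile : Cmd → ℕ → Program
  | .skip, _ => .skip
  | .set k i v, d =>
      .store (.sub (.mul (.const (-16)) (i.compile d)) (.const (2 + (k : ℕ)))) (v.compile d)
  | .seq p q, d => .seq (p.compile d) (q.compile d)
  | .ite e p q, d => .ifPos (e.compile d) (p.compile d) (q.compile d)
  | .loop c b p, d =>
      .seq (.store (.const (-16 * (d : ℤ) - 1)) (.const 0))
        (.whilePos (.sub (.mul (.const (c : ℤ)) (.load (.const (-16 * (cond b 2 1)))))
            (.load (.const (-16 * (d : ℤ) - 1))))
          (.seq (p.compile (d + 1))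
            (.store (.const (-16 * (d : ℤ) - 1))
              (.add (.load (.const (-16 * (d : ℤ) - 1))) (.const 1)))))

/-- The weight of a store of the initial value of a loop counter. -/
def counterInitWeight (d : ℕ) : ℕ := bitLength (-16 * (d : ℤ) - 1) + bitLength 0 + 2

/-- The weight of the test of a loop. -/
def counterTestWeight (c : ℕ) (b : Bool) (d : ℕ) : ℕ :=
  (bitLength (c : ℤ) + (bitLength (-16 * (cond b 2 1)) + 2) + 2 + bitLength (c : ℤ)) +
    (bitLength (-16 * (d : ℤ) - 1) + 2) + 2

/-- The weight of the increment of a loop counter. -/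
def counterStepWeight (d : ℕ) : ℕ :=
  bitLength (-16 * (d : ℤ) - 1) + ((bitLength (-16 * (d : ℤ) - 1) + 2) + bitLength 1 + 2) + 2

open Polynomial in
/-- A weight of the compiled command. -/
noncomputable def Cmd.weight : Cmd → ℕ → ℕ[X]
  | .skip, _ => 1
  | .set k i v, _ =>
      C (2 * bitLength (-16) + bitLength (2 + ((k : ℕ) : ℤ)) + 6) + i.weight + v.weight
  | .seq p q, d => p.weight d + q.weight d
  | .ite e p q, d => e.weight + 1 + p.weight d + q.weight d
  | .loop c b p, d =>
      C (counterInitWeight d) + (C c * X * (C (counterTestWeight c b d) + 1 +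
        (p.weight (d + 1) + C (counterStepWeight d))) + (C (counterTestWeight c b d) + 1))

/-- The memory `σ` represents the input `P`, the counters of the first `d` loops, and the
arrays `S`. -/
structure Represents (P : ℤ → ℤ) (d : ℕ) (env : ℕ → ℤ) (S : Arrays) (σ : Store) : Prop where
  inp : ∀ i, σ (-16 * i) = P i
  ctr : ∀ i < d, σ (-16 * (i : ℤ) - 1) = env i
  arr : ∀ (k : Fin 14) (i : ℤ), σ (-16 * i - (2 + ((k : ℕ) : ℤ))) = S k i
  env_eq_zero : ∀ i, d ≤ i → env i = 0

theorem Ex.eval_compile {P : ℤ → ℤ} {d : ℕ} {env : ℕ → ℤ} {S : Arrays} {σ : Store}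
    (h : Represents P d env S σ) (e : Ex) : (e.compile d).eval σ = e.eval P env S := by
  induction e with
  | const z => rfl
  | ctr i =>
    simp only [Ex.compile, Ex.eval]
    split_ifs with hi
    · exact h.ctr i hi
    · exact (h.env_eq_zero i (by omega)).symm
  | inp i ih => simp only [Ex.compile, Ex.eval, Expr.eval, ih, h.inp]
  | arr k i ih => simp only [Ex.compile, Ex.eval, Expr.eval, ih, h.arr]
  | add e f ihe ihf => simp only [Ex.compile, Ex.eval, Expr.eval, ihe, ihf]
  | sub e f ihe ihf => simp only [Ex.compile, Ex.eval, Expr.eval, ihe, ihf]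
  | scale z e ih => simp only [Ex.compile, Ex.eval, Expr.eval, ih]
  | mulInp i e ihi ihe => simp only [Ex.compile, Ex.eval, Expr.eval, ihi, ihe, h.inp]

theorem Expr.Within.mono {e : Expr} {σ : Store} {K w u : ℕ} (h : e.Within σ K w) (hw : w ≤ u) :
    e.Within σ K u :=
  ⟨h.1.trans (Nat.mul_le_mul hw (by omega)), h.2.trans (by omega)⟩

/-- The polynomials are evaluated at a bit bound `N` for input entries. Only `mulInp` needs it;
every other operation adds a constant number of bits. -/
theorem Ex.within {P : ℤ → ℤ} {d : ℕ} {env : ℕ → ℤ} {S : Arrays} {σ : Store} {N K : ℕ}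
    (hP : ∀ i, bitLength (P i) ≤ N) (hσ : Bits K σ)
    (h : Represents P d env S σ) (e : Ex) : (e.compile d).Within σ K (e.weight.eval N) := by
  induction e with
  | const z => simpa [Ex.compile, Ex.weight] using Expr.Within.const z σ K
  | ctr i =>
    simp only [Ex.compile]
    split_ifs with hi
    · exact ((Expr.Within.const _ σ K).load hσ).mono (by simp [Ex.weight])
    · refine (Expr.Within.const _ σ K).mono ?_
      simp [Ex.weight, bitLength]
  | inp i ih =>
    refine ((Expr.Within.mul (.const _ σ K) le_rfl ih).load hσ).mono ?_
    simp only [Ex.weight, Polynomial.eval_add, Polynomial.eval_C, Expr.eval]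
    omega
  | arr k i ih =>
    refine (((Expr.Within.mul (.const _ σ K) le_rfl ih).sub (.const _ σ K)).load hσ).mono ?_
    simp only [Ex.weight, Polynomial.eval_add, Polynomial.eval_C, Expr.eval]
    omega
  | add e f ihe ihf => exact (ihe.add ihf).mono (by simp [Ex.weight])
  | sub e f ihe ihf => exact (ihe.sub ihf).mono (by simp [Ex.weight])
  | scale z e ih =>
    refine (Expr.Within.mul (.const _ σ K) le_rfl ih).mono ?_
    simp only [Ex.weight, Polynomial.eval_add, Polynomial.eval_C, Expr.eval]
    omega
  | mulInp i e ihi ihe =>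
    refine (Expr.Within.mul ((Expr.Within.mul (.const _ σ K) le_rfl ihi).load hσ) (B := N) ?_
      ihe).mono ?_
    · simp only [Expr.eval, h.inp]
      exact hP _
    · simp only [Ex.weight, Polynomial.eval_add, Polynomial.eval_C, Expr.eval, Polynomial.eval_X]
      omega

/-- Loop lengths are read from the input, which never changes, and are at most `c * N`; so the
weight of a loop is a polynomial in `N` times that of its body, whatever the arrays contain. -/
theorem Cmd.runsWithin {P : ℤ → ℤ} {N : ℕ} (hP : ∀ i, bitLength (P i) ≤ N)
    (hlen : ∀ b : Bool, 0 ≤ P (cond b 2 1) ∧ P (cond b 2 1) ≤ N) (p : Cmd) :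
    ∀ {d : ℕ} {env : ℕ → ℤ} {S : Arrays} {σ : Store} {K : ℕ}, Bits K σ →
      Represents P d env S σ →
      ∃ τ, RunsWithin (p.compile d) σ K ((p.weight d).eval N) τ ∧
        Represents P d env (p.run P d env S) τ := by
  induction p with
  | skip => exact fun hσ h => ⟨_, by simpa [Cmd.weight, Cmd.compile] using RunsWithin.skip hσ, h⟩
  | set k i v =>
    intro d env S σ K hσ h
    refine ⟨_, (RunsWithin.store hσ ((Expr.Within.mul (.const _ σ K) le_rfl
      (i.within hP hσ h)).sub (.const _ σ K)) (v.within hP hσ h)).mono ?_, ?_⟩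
    · simp only [Cmd.weight, Polynomial.eval_add, Polynomial.eval_C, Expr.eval]
      omega
    -- Input, counters and the fourteen arrays occupy the sixteen residue classes modulo 16, so a
    -- write to one of them leaves the others alone.
    · have hk := k.isLt
      simp only [Expr.eval, Ex.eval_compile h, Cmd.run]
      refine ⟨fun j => ?_, fun j hj => ?_, fun k' j => ?_, h.env_eq_zero⟩
      · rw [Function.update_of_ne (by omega), h.inp]
      · rw [Function.update_of_ne (by omega), h.ctr j hj]
      · rw [Function.update_apply, h.arr]
        have hk' := k'.isLt
        simp only [Arrays.set]
        congr 1
        rw [Fin.ext_iff]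
        apply propext
        constructor
        · intro h; constructor <;> omega
        · rintro ⟨h1, h2⟩
          rw [h1, h2]
  | seq p q ihp ihq =>
    intro d env S σ K hσ h
    obtain ⟨τ, h1, h2⟩ := ihp hσ h
    have hτ : Bits (K + (p.weight d).eval N) τ := h1.choose_spec.2.2
    obtain ⟨ρ, k1, k2⟩ := ihq hτ h2
    exact ⟨ρ, by simpa [Cmd.weight, Cmd.compile] using h1.seq k1, k2⟩
  | ite e p q ihp ihq =>
    intro d env S σ K hσ h
    simp only [Cmd.run, ifPos, Cmd.compile, Cmd.weight, Polynomial.eval_add, Polynomial.eval_one]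
    split_ifs with he
    · obtain ⟨τ, h1, h2⟩ := ihp hσ h
      exact ⟨τ, (RunsWithin.ifTrue (e.within hP hσ h) (by rwa [e.eval_compile h]) h1).mono
        (by omega), h2⟩
    · obtain ⟨τ, h1, h2⟩ := ihq hσ h
      exact ⟨τ, (RunsWithin.ifFalse (e.within hP hσ h) (by rwa [e.eval_compile h]) h1).mono
        (by omega), h2⟩
  | loop c b p ih =>
    intro d env S σ K hσ h
    obtain ⟨hb0, hbN⟩ := hlen b
    obtain ⟨l, hl⟩ := Int.eq_ofNat_of_zero_le hb0
    have hl' : (P (cond b 2 1)).toNat = l := by omega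
    set n := c * l with hn
    let T : ℕ → Arrays := fun j => Nat.rec S
      (fun i T => p.run P (d + 1) (Function.update env d (i : ℤ)) T) j
    let I : ℕ → Store → Prop := fun i τ =>
      Represents P (d + 1) (Function.update env d (i : ℤ)) (T i) τ
    have hstart := RunsWithin.store hσ (Expr.Within.const (-16 * (d : ℤ) - 1) σ K)
      (Expr.Within.const 0 σ K)
    have hbits := hstart.choose_spec.2.2
    have hI0 : I 0 (Function.update σ ((Expr.const (-16 * (d : ℤ) - 1)).eval σ)
        ((Expr.const 0).eval σ)) := by
      simp only [Expr.eval]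
      refine ⟨fun j => ?_, fun j hj => ?_, fun k j => ?_, fun j hj => ?_⟩
      · rw [Function.update_of_ne (by omega), h.inp]
      · rcases eq_or_ne j d with rfl | hjd
        · simp
        · rw [Function.update_of_ne (by omega), Function.update_of_ne hjd, h.ctr j (by omega)]
      · have := k.isLt
        rw [Function.update_of_ne (by omega), h.arr]
        rfl
      · rw [Function.update_of_ne (by omega), h.env_eq_zero j (by omega)]
    have heval : ∀ i σ, I i σ → (Expr.sub (.mul (.const (c : ℤ))
        (.load (.const (-16 * (cond b 2 1))))) (.load (.const (-16 * (d : ℤ) - 1)))).eval σ =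
        (n : ℤ) - i := by
      intro i σ hi
      simp only [Expr.eval, hi.inp, hi.ctr d (by omega), hl, Function.update_self, hn]
      push_cast
      rfl
    obtain ⟨τ, h1, h2⟩ := RunsWithin.while_invariant
      (e := .sub (.mul (.const (c : ℤ)) (.load (.const (-16 * (cond b 2 1)))))
            (.load (.const (-16 * (d : ℤ) - 1))))
      (p := .seq (p.compile (d + 1))
            (.store (.const (-16 * (d : ℤ) - 1))
              (.add (.load (.const (-16 * (d : ℤ) - 1))) (.const 1)))) I (n := n)
      (w := counterTestWeight c b d) (u := (p.weight (d + 1)).eval N + counterStepWeight d)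
      (fun i _ K σ hσ _ => (Expr.Within.mul (.const _ σ K) le_rfl
        ((Expr.Within.const _ σ K).load hσ)).sub ((Expr.Within.const _ σ K).load hσ))
      (fun i hi σ h => by rw [heval i σ h]; omega)
      (fun σ h => by rw [heval n σ h]; omega)
      (fun i hi K σ hσ h => by
        obtain ⟨τ, h1, h2⟩ := ih hσ h
        have hτ := h1.choose_spec.2.2
        refine ⟨_, h1.seq (.store hτ (.const _ τ _)
          (((Expr.Within.const _ τ _).load hτ).add (.const _ τ _))), ?_⟩
        simp only [Expr.eval, h2.ctr d (by omega), Function.update_self]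
        refine ⟨fun j => ?_, fun j hj => ?_, fun k j => ?_, fun j hj => ?_⟩
        · rw [Function.update_of_ne (by omega), h2.inp]
        · rcases eq_or_ne j d with rfl | hjd
          · simp
          · rw [Function.update_of_ne (by omega), Function.update_of_ne hjd, h2.ctr j (by omega),
              Function.update_of_ne hjd]
        · have := k.isLt
          rw [Function.update_of_ne (by omega), h2.arr]
        · rw [Function.update_of_ne (by omega)]
          have := h2.env_eq_zero j hj
          rwa [Function.update_of_ne (by omega)] at this)
      hbits hI0
    refine ⟨τ, (hstart.seq h1).mono ?_, ?_⟩
    · simp only [Cmd.weight, Polynomial.eval_add, Polynomial.eval_mul, Polynomial.eval_C,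
        Polynomial.eval_X, Polynomial.eval_one, counterInitWeight]
      have : n ≤ c * N := Nat.mul_le_mul_left c (by omega)
      gcongr
    · simp only [Cmd.run, hl']
      -- The cell of counter `d` keeps its last value, but a representation at depth `d` does not
      -- look at it.
      refine ⟨h2.inp, fun j hj => ?_, h2.arr, h.env_eq_zero⟩
      rw [h2.ctr j (by omega), Function.update_of_ne (by omega)]

/-! ### Input and output -/

/-- Copy the cells `b i + g` to the cells `a i`, in the order of decreasing `i`, where the
first value of `i` is in cell `-1`. -/
def copyLoop (a b g : ℤ) : Program :=
  .whilePos (.load (.const (-1)))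
    (.seq (.store (.mul (.const a) (.load (.const (-1))))
        (.load (.sub (.mul (.const b) (.load (.const (-1)))) (.const g))))
      (.store (.const (-1)) (.sub (.load (.const (-1))) (.const 1))))

/-- The weight of the test of `copyLoop`. -/
def copyTestWeight : ℕ := bitLength (-1) + 2

/-- The weight of the body of `copyLoop`. -/
def copyStepWeight (a b g : ℤ) : ℕ :=
  ((bitLength a + (bitLength (-1) + 2) + 2 + bitLength a) +
    (((bitLength b + (bitLength (-1) + 2) + 2 + bitLength b) + bitLength g + 2) + 2) + 2) +
  (bitLength (-1) + ((bitLength (-1) + 2) + bitLength 1 + 2) + 2)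

/-- Counting down lets cell `-1` serve both as index and as loop test. The hypotheses say that
targets are distinct and that the counter, the targets and the sources do not meet. -/
theorem copyLoop_runsWithin {a b g : ℤ} {n : ℕ} {σ : Store} {K : ℕ} (hσ : Bits K σ)
    (hn : σ (-1) = n) (ha : ∀ i : ℤ, 0 < i → a * i ≠ -1)
    (hinj : ∀ i j : ℤ, a * i = a * j → i = j)
    (hab : ∀ i j : ℤ, 0 < i → 0 < j → a * i ≠ b * j - g)
    (hb : ∀ i : ℤ, 0 < i → b * i - g ≠ -1) :
    ∃ τ, RunsWithin (copyLoop a b g) σ K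
        (n * (copyTestWeight + 1 + copyStepWeight a b g) + (copyTestWeight + 1)) τ ∧
      (∀ i : ℤ, 0 < i → i ≤ n → τ (a * i) = σ (b * i - g)) ∧
      (∀ j : ℤ, j ≠ -1 → (∀ i : ℤ, 0 < i → i ≤ n → j ≠ a * i) → τ j = σ j) := by
  -- After `k` rounds exactly the indices above `n - k` have been copied.
  let I : ℕ → Store → Prop := fun k τ => τ (-1) = (n : ℤ) - k ∧
    (∀ i : ℤ, (n : ℤ) - k < i → 0 < i → i ≤ n → τ (a * i) = σ (b * i - g)) ∧
    (∀ j : ℤ, j ≠ -1 → (∀ i : ℤ, (n : ℤ) - k < i → 0 < i → i ≤ n → j ≠ a * i) → τ j = σ j)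
  obtain ⟨τ, h1, -, h2, h3⟩ := RunsWithin.while_invariant (e := .load (.const (-1)))
    (p := .seq (.store (.mul (.const a) (.load (.const (-1))))
        (.load (.sub (.mul (.const b) (.load (.const (-1)))) (.const g))))
      (.store (.const (-1)) (.sub (.load (.const (-1))) (.const 1))))
    I (n := n) (w := copyTestWeight) (u := copyStepWeight a b g)
    (fun i _ K σ hσ _ => (Expr.Within.const _ σ K).load hσ)
    (fun i hi τ h => by simp only [Expr.eval, h.1]; omega)
    (fun τ h => by simp only [Expr.eval, h.1]; omega)
    (fun k hk K τ hτ h => by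
      obtain ⟨h1, h2, h3⟩ := h
      have hs := RunsWithin.store hτ
        (Expr.Within.mul (.const a τ K) le_rfl ((Expr.Within.const (-1) τ K).load hτ))
        (((Expr.Within.mul (.const b τ K) le_rfl
          ((Expr.Within.const (-1) τ K).load hτ)).sub (.const g τ K)).load hτ)
      have hs' := hs.choose_spec.2.2
      refine ⟨_, hs.seq (.store hs' (.const _ _ _)
        (((Expr.Within.const _ _ _).load hs').sub (.const _ _ _))), ?_⟩
      simp only [Expr.eval, h1]
      rw [Function.update_of_ne (ha _ (by omega)).symm, h1]
      have hval : τ (b * (n - k) - g) = σ (b * (n - k) - g) := by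
        refine h3 _ (hb _ (by omega)) fun i _ h _ => (hab i _ h (by omega)).symm
      rw [hval]
      refine ⟨by simp; ring, fun i hi1 hi2 hi3 => ?_, fun j hj hij => ?_⟩
      · rw [Function.update_of_ne (ha _ hi2)]
        rcases eq_or_ne i (n - k) with rfl | hne
        · rw [Function.update_self]
        · rw [Function.update_of_ne (fun h => hne (hinj _ _ h)),
            h2 i (by push_cast at hi1; omega) hi2 hi3]
      · rw [Function.update_of_ne hj, Function.update_of_ne (hij _ (by push_cast; omega) (by omega)
          (by omega)), h3 j hj fun i hi => hij i (by push_cast; omega)])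
    hσ
    ⟨by simpa using hn, fun i hi _ hi' => by omega, fun j _ _ => rfl⟩
  exact ⟨τ, h1, fun i hi => h2 i (by omega) hi, fun j hj hij => h3 j hj fun i _ => hij i⟩

theorem bitLength_le_inputLength {w : List ℤ} {z : ℤ} (h : z ∈ w) :
    bitLength z ≤ inputLength w :=
  List.single_le_sum (by simp) _ (List.mem_map_of_mem h)

theorem length_le_inputLength (w : List ℤ) : w.length ≤ inputLength w := by
  have := List.card_nsmul_le_sum (w.map bitLength) 1 (by
    simp only [List.mem_map]
    rintro _ ⟨z, -, rfl⟩
    exact one_le_bitLength z)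
  simpa [inputLength] using this

theorem bits_inputStore (w : List ℤ) : Bits (inputLength w + 1) (inputStore w) := by
  intro i
  unfold inputStore
  split_ifs with h1 h2
  · have := bitLength_natCast_le w.length
    have := length_le_inputLength w
    omega
  · rcases lt_or_ge (i.toNat - 1) w.length with h | h
    · rw [List.getD_eq_getElem _ _ h]
      exact (bitLength_le_inputLength (List.getElem_mem h)).trans (by omega)
    · rw [List.getD_eq_default _ _ h]
      simp [bitLength]
  · simp [bitLength]

/-- The program that copies the input, runs a compiled command, and copies array `12` to the
output cells. -/
def Cmd.toProgram (p : Cmd) : Program :=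
  .seq (.seq (.store (.const (-1)) (.load (.const 0))) (copyLoop (-16) 1 0))
    (.seq (p.compile 0)
      (.seq (.store (.const (-1)) (.load (.const (-14))))
        (.seq (.store (.const 0) (.load (.const (-14)))) (copyLoop 1 (-16) 14))))

/-- A problem is solvable in polynomial time if it is solved by a command, where entry `0` of
array `12` has to hold the length of the output, followed by the output. -/
theorem solvableInPolyTime_of_cmd {ι : Type} {α : ι → Type} {encIn : ι → List ℤ}
    {encOut : (x : ι) → α x → List ℤ} {Correct : (x : ι) → α x → Prop} {valid : Set ι} (p : Cmd)
    (hlen : ∀ x ∈ valid, ∀ b : Bool, 0 ≤ inputStore (encIn x) (cond b 2 1) ∧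
      inputStore (encIn x) (cond b 2 1) ≤ inputLength (encIn x))
    (h : ∀ x ∈ valid, ∀ (P : ℤ → ℤ) (S : Arrays), (∀ i, 0 ≤ i → P i = inputStore (encIn x) i) →
      ∃ y, Correct x y ∧ (encOut x y).length ≤ (encIn x).length ∧
        (p.run P 0 (fun _ => 0) S) 12 0 = (encOut x y).length ∧
        ∀ i : Fin (encOut x y).length,
          (p.run P 0 (fun _ => 0) S) 12 ((i : ℕ) + 1 : ℤ) = (encOut x y).get i) :
    SolvableInPolyTime encIn encOut Correct valid := by
  open Polynomial in
  let W : ℕ[X] := (C (bitLength (-1) + (bitLength 0 + 2) + 2) +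
      (X * C (copyTestWeight + 1 + copyStepWeight (-16) 1 0) + C (copyTestWeight + 1))) +
    ((p.weight 0).comp (X + 1) + (C (bitLength (-1) + (bitLength (-14) + 2) + 2) +
      (C (bitLength 0 + (bitLength (-14) + 2) + 2) +
        (X * C (copyTestWeight + 1 + copyStepWeight 1 (-16) 14) + C (copyTestWeight + 1)))))
  -- A run of weight $W$ from cells of $L+1$ bits costs at most $W(L+1+W)$. The extra bit covers
  -- cell `0`, which holds the word length.
  refine ⟨p.toProgram, W * (Polynomial.X + 1 + W), fun x hx => ?_⟩
  set w := encIn x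
  set L := inputLength w
  have hwL := length_le_inputLength w
  have hσ := bits_inputStore w
  have hs1 := RunsWithin.store hσ (Expr.Within.const (-1) _ _)
    ((Expr.Within.const 0 _ _).load hσ)
  have hb1 := hs1.choose_spec.2.2
  obtain ⟨τ, hc, hτ1, hτ2⟩ := copyLoop_runsWithin (a := -16) (b := 1) (g := 0) (n := w.length)
    hb1 (by simp [Expr.eval, inputStore]) (by omega) (by omega) (by omega) (by omega)
  simp only [Expr.eval] at hτ1 hτ2 hc
  have hs2 := hs1.seq hc
  have hb2 := hs2.choose_spec.2.2
  have hP : ∀ i, 0 ≤ i → τ (-16 * i) = inputStore w i := by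
    intro i hi
    rcases eq_or_ne i 0 with rfl | hi0
    · rw [hτ2 _ (by omega) (by omega), Function.update_of_ne (by omega)]
      simp
    rcases le_or_gt i w.length with hiw | hiw
    · rw [hτ1 i (by omega) hiw, Function.update_of_ne (by omega)]
      simp
    · rw [hτ2 _ (by omega) (by omega), Function.update_of_ne (by omega)]
      have h1 : inputStore w (-16 * i) = 0 := by
        unfold inputStore
        rw [if_neg (by omega), if_neg (by omega)]
      have h2 : inputStore w i = 0 := by
        unfold inputStore
        rw [if_neg hi0, if_pos (by omega), List.getD_eq_default _ _ (by omega)]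
      rw [h1, h2]
  -- For negative `i` these are untouched cells at positive addresses. Their values are not
  -- controlled, but their bit lengths are.
  have hPbits : ∀ i, bitLength (τ (-16 * i)) ≤ L + 1 := by
    intro i
    rcases le_or_gt 0 i with hi | hi
    · rw [hP i hi]
      exact hσ i
    · rw [hτ2 _ (by omega) (by omega), Function.update_of_ne (by omega)]
      exact hσ _
  let S : Arrays := fun k i => τ (-16 * i - (2 + ((k : ℕ) : ℤ)))
  -- Cell `-1`, left over from copying, is the place of counter `0`; at depth zero nothing is
  -- required of it.
  have hrep : Represents (fun i => τ (-16 * i)) 0 (fun _ => 0) S τ :=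
    ⟨fun i => rfl, fun i hi => by omega, fun k i => rfl, fun _ _ => rfl⟩
  obtain ⟨ρ, hr, hρ⟩ := p.runsWithin (N := L + 1) hPbits (fun b => by
    have h1 := hlen x hx b
    have h2 := hP (bif b then 2 else 1) (by cases b <;> simp)
    show 0 ≤ τ _ ∧ τ _ ≤ _
    rw [h2]
    push_cast
    exact ⟨h1.1, h1.2.trans (show (L : ℤ) ≤ _ by omega)⟩) hb2 hrep
  have hb3 := hr.choose_spec.2.2
  obtain ⟨y, hcorrect, hle, hout0, hout⟩ := h x hx _ S hP
  -- Entry `i` of array `12` lies in cell `-16 i - 14`, so cell `-14` holds the output length.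
  have hρ0 : ρ (-14) = (encOut x y).length := by
    rw [← hout0, ← hρ.arr 12 0]
    rfl
  have hs3 := RunsWithin.store hb3 (Expr.Within.const (-1) _ _)
    ((Expr.Within.const (-14) _ _).load hb3)
  have hb4 := hs3.choose_spec.2.2
  have hs4 := RunsWithin.store hb4 (Expr.Within.const 0 _ _)
    ((Expr.Within.const (-14) _ _).load hb4)
  have hb5 := hs4.choose_spec.2.2
  obtain ⟨υ, hc2, hυ1, hυ2⟩ := copyLoop_runsWithin (a := 1) (b := -16) (g := 14)
    (n := (encOut x y).length) hb5 (by
      simp only [Expr.eval]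
      rw [Function.update_of_ne (by omega), Function.update_self, hρ0])
    (by omega) (by omega) (by omega) (by omega)
  have hrun := hs2.seq (hr.seq (hs3.seq (hs4.seq hc2)))
  obtain ⟨t, ht1, ht2, ht3⟩ := hrun
  refine ⟨t, υ, y, ht1, ht2.trans ?_, ⟨?_, fun i => ?_⟩, hcorrect⟩
  · simp only [W, Polynomial.eval_add, Polynomial.eval_mul, Polynomial.eval_C,
      Polynomial.eval_X, Polynomial.eval_one, Polynomial.eval_comp]
    have : (encOut x y).length ≤ L := hle.trans hwL
    gcongr
  · rw [hυ2 0 (by omega) (by omega)]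
    simp only [Expr.eval]
    rw [Function.update_self, Function.update_of_ne (by omega), hρ0]
  · have hi := i.isLt
    have h1 := hυ1 ((i : ℕ) + 1 : ℤ) (by omega) (by omega)
    rw [one_mul] at h1
    rw [h1]
    simp only [Expr.eval]
    rw [Function.update_of_ne (by omega), Function.update_of_ne (by omega), ← hout i,
      ← hρ.arr 12]
    rfl

end RAM

namespace COPIC

open Finset

/-! ### Integral flows and paths -/

/-- The edge `e` can be traversed from `u` to `v`; backwards only if `und` is true. -/
def Traverses {V E : Type} (ends : E → V × V) (und : Bool) (e : E) (u v : V) : Prop :=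
  ends e = (u, v) ∨ und = true ∧ ends e = (v, u)

/-- `F` is an `s`-`t`-flow of value `k`, where `F e` is the amount sent from the first to the
second end of `e`. Flow conservation is stated in the weak form, for all test functions. -/
def IsFlow {V E : Type} [Fintype E] (ends : E → V × V) (s t : V) (F : E → ℤ) (k : ℤ) : Prop :=
  ∀ φ : V → ℤ, ∑ e, F e * (φ (ends e).2 - φ (ends e).1) = k * (φ t - φ s)

section Flow

variable {V E : Type} {ends : E → V × V} {s t : V}

theorem IsWalk.mono {L L' : E → V → V → Prop} (hL : ∀ e u v, L e u v → L' e u v) {p : List (E × V)} :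
    ∀ {u v : V}, IsWalk L u p v → IsWalk L' u p v := by
  induction p with
  | nil => exact fun h => h
  | cons a p ih => exact fun h => ⟨hL _ _ _ h.1, ih h.2⟩

theorem IsWalk.ends_mem {und : Bool} {p : List (E × V)} {u v : V}
    (h : IsWalk (Traverses ends und) u p v) {e : E} (he : e ∈ p.map Prod.fst) :
    (ends e).1 ∈ u :: p.map Prod.snd ∧ (ends e).2 ∈ u :: p.map Prod.snd := by
  induction p generalizing u with
  | nil => simp at he
  | cons a p ih =>
    obtain ⟨f, w⟩ := a
    rw [List.map_cons, List.mem_cons] at he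
    rcases he with rfl | he
    · rcases h.1 with h1 | ⟨-, h1⟩ <;> simp [h1]
    · have := ih h.2 he
      simp only [List.map_cons]
      exact ⟨List.mem_cons_of_mem _ this.1, List.mem_cons_of_mem _ this.2⟩

/-- A set of vertices that contains `s` and is closed under traversal contains the end of every
walk from `s`. -/
theorem IsWalk.mem_of_closed {L : E → V → V → Prop} {R : Set V}
    (hR : ∀ e u v, L e u v → u ∈ R → v ∈ R) {p : List (E × V)} {u v : V} (h : IsWalk L u p v)
    (hu : u ∈ R) : v ∈ R := by
  induction p generalizing u with
  | nil =>
    obtain rfl : u = v := h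
    exact hu
  | cons a p ih => exact ih h.2 (hR _ _ _ h.1 hu)

variable [Fintype E]

theorem IsFlow.zero : IsFlow ends s t (fun _ => 0) 0 := by
  intro φ
  simp

theorem IsFlow.add {F F' : E → ℤ} {k k' : ℤ} (h : IsFlow ends s t F k)
    (h' : IsFlow ends s t F' k') : IsFlow ends s t (fun e => F e + F' e) (k + k') := by
  intro φ
  simp only [add_mul, sum_add_distrib, h φ, h' φ]

theorem IsFlow.sub {F F' : E → ℤ} {k k' : ℤ} (h : IsFlow ends s t F k)
    (h' : IsFlow ends s t F' k') : IsFlow ends s t (fun e => F e - F' e) (k - k') := by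
  intro φ
  simp only [sub_mul, sum_sub_distrib, h φ, h' φ]

/-- The edge `e` carries one unit from `u` to `v`. -/
theorem IsFlow.single [DecidableEq E] {e : E} {u v : V} {x : ℤ}
    (h : x = 1 ∧ ends e = (u, v) ∨ x = -1 ∧ ends e = (v, u)) :
    IsFlow ends u v (fun e' => if e' = e then x else 0) 1 := by
  intro φ
  simp only [ite_mul, zero_mul, sum_ite_eq', mem_univ, if_true]
  rcases h with ⟨rfl, h⟩ | ⟨rfl, h⟩ <;> rw [h] <;> simp

theorem IsFlow.trans {u : V} {F F' : E → ℤ} {k : ℤ} (h : IsFlow ends s u F k)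
    (h' : IsFlow ends u t F' k) : IsFlow ends s t (fun e => F e + F' e) k := by
  intro φ
  simp only [add_mul, sum_add_distrib, h φ, h' φ]
  ring

/-- A simple path carries a flow of value one. -/
theorem IsWalk.exists_isFlow [DecidableEq E] {und : Bool} {p : List (E × V)} {u v : V}
    (h : IsWalk (Traverses ends und) u p v) (hnd : (u :: p.map Prod.snd).Nodup) :
    ∃ x : E → ℤ, IsFlow ends u v x 1 ∧ ∀ e, |x e| ≤ 1 ∧ (e ∉ p.map Prod.fst → x e = 0) ∧
      (und = false → 0 ≤ x e) := by
  induction p generalizing u with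
  | nil =>
    obtain rfl : u = v := h
    exact ⟨fun _ => 0, fun φ => by simp, fun e => by simp⟩
  | cons a p ih =>
    obtain ⟨f, w⟩ := a
    simp only [List.map_cons] at hnd
    obtain ⟨x, hx, hx'⟩ := ih h.2 hnd.of_cons
    -- If `f` occurred again, the rest of the walk would revisit `u`. So each edge carries at most
    -- one unit.
    have hf : f ∉ p.map Prod.fst := by
      intro hf
      have h1 := h.2.ends_mem hf
      have h2 := (List.nodup_cons.1 hnd).1
      rcases h.1 with h3 | ⟨-, h3⟩
      · rw [h3] at h1; exact h2 h1.1
      · rw [h3] at h1; exact h2 h1.2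
    obtain ⟨z, hz, hz1, hz2⟩ : ∃ z : ℤ, (z = 1 ∧ ends f = (u, w) ∨ z = -1 ∧ ends f = (w, u)) ∧
        |z| ≤ 1 ∧ (und = false → 0 ≤ z) := by
      rcases h.1 with h3 | ⟨h4, h3⟩
      · exact ⟨1, .inl ⟨rfl, h3⟩, by simp, by simp⟩
      · exact ⟨-1, .inr ⟨rfl, h3⟩, by simp, by simp [h4]⟩
    refine ⟨_, (IsFlow.single hz).trans hx, fun e => ?_⟩
    by_cases he : e = f
    · subst he
      simpa [(hx' e).2.1 hf, hz1] using hz2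
    · simpa [he] using hx' e

/-- A set of vertices that contains `s` but not `t` is left by the support of any positive flow. -/
theorem IsFlow.mem_of_closed {F : E → ℤ} {k : ℤ} (h : IsFlow ends s t F k) (hk : 0 < k)
    {R : Set V} (hs : s ∈ R) (hpos : ∀ e, 0 < F e → (ends e).1 ∈ R → (ends e).2 ∈ R)
    (hneg : ∀ e, F e < 0 → (ends e).2 ∈ R → (ends e).1 ∈ R) : t ∈ R := by
  classical
  by_contra ht
  -- Testing against the indicator of `R` gives `-k < 0`, whereas every edge contributes a
  -- nonnegative amount because no support leaves `R`.
  have h1 := h (fun v => if v ∈ R then 1 else 0)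
  simp only [hs, ht, if_true, if_false] at h1
  have h2 : 0 ≤ ∑ e, F e * ((if (ends e).2 ∈ R then (1 : ℤ) else 0) -
      (if (ends e).1 ∈ R then 1 else 0)) := by
    refine sum_nonneg fun e _ => ?_
    rcases lt_trichotomy (F e) 0 with he | he | he
    · have := hneg e he
      split_ifs <;> first | (exfalso; tauto) | nlinarith
    · simp [he]
    · have := hpos e he
      split_ifs <;> first | (exfalso; tauto) | nlinarith
  omega

/-! ### Convex costs -/

/-- The cost of sending `z` units through an edge, `-2 ≤ z ≤ 2`. -/
def edgeCost (c a z : ℤ) : ℤ := c * |z| + if |z| = 2 then a else 0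

/-- The cost of increasing the flow through an edge from `z` to `z + 1`, `-2 ≤ z < 2`. -/
def residualLength (c a z : ℤ) : ℤ :=
  if 0 < z then c + a else if 0 < z + 1 then c else if 0 < z + 2 then -c else -(c + a)

/-- The flow `z` through an edge is optimal if the potential difference of its ends is `y`. -/
def IsTight (lo c a y z : ℤ) : Prop :=
  (z < 2 → 0 ≤ residualLength c a z - y) ∧ (0 < z + lo → 0 ≤ residualLength c a (-z) + y)

/-- This is the subgradient inequality. The edge cost has slopes $-(c+a),-c,c,c+a$, which increase,
and tightness puts `y` between the slopes to the left and to the right of `z`. With so few values a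
case check suffices. -/
theorem edgeCost_le {lo c a y z h : ℤ} (hc : 0 ≤ c) (ha : 0 ≤ a) (hlo : lo = 0 ∨ lo = 2)
    (hz : -lo ≤ z) (hz' : z ≤ 2) (hh : -lo ≤ h) (hh' : h ≤ 2) (ht : IsTight lo c a y z) :
    edgeCost c a z + (h - z) * y ≤ edgeCost c a h := by
  unfold IsTight residualLength at ht
  unfold edgeCost
  rcases hlo with rfl | rfl
  · interval_cases z <;> interval_cases h <;> norm_num at ht ⊢ <;> linarith
  · interval_cases z <;> interval_cases h <;> norm_num at ht ⊢ <;> linarith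

/-- Zero reduced length means that `y` is the slope of the unit segment that is traversed, hence a
subgradient at both of its ends. Using both orientations changes nothing, so that case need not be
excluded. -/
theorem IsTight.augment {lo c a y z p q : ℤ} (hc : 0 ≤ c) (ha : 0 ≤ a) (hlo : lo = 0 ∨ lo = 2)
    (hz : -lo ≤ z) (hz' : z ≤ 2) (ht : IsTight lo c a y z)
    (hp : p = 0 ∨ p = 1 ∧ z < 2 ∧ residualLength c a z - y = 0)
    (hq : q = 0 ∨ q = 1 ∧ 0 < z + lo ∧ residualLength c a (-z) + y = 0) :
    IsTight lo c a y (z + p - q) ∧ -lo ≤ z + p - q ∧ z + p - q ≤ 2 := by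
  refine ⟨?_, by omega, by omega⟩
  rcases hp with rfl | ⟨rfl, hp, hp'⟩ <;> rcases hq with rfl | ⟨rfl, hq, hq'⟩
  · simpa using ht
  · unfold IsTight residualLength at *
    rcases hlo with rfl | rfl <;> interval_cases z <;> norm_num at * <;>
      (try constructor) <;> linarith
  · unfold IsTight residualLength at *
    rcases hlo with rfl | rfl <;> interval_cases z <;> norm_num at * <;>
      (try constructor) <;> linarith
  · simpa using ht

/-- Linear programming duality: the linear terms of the subgradient inequalities sum to zero,
because `h - F` is a circulation and is tested against the potential `π`. -/
theorem sum_edgeCost_le {lo k : ℤ} {c a F h : E → ℤ} {π : V → ℤ} (hc : ∀ e, 0 ≤ c e)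
    (ha : ∀ e, 0 ≤ a e) (hlo : lo = 0 ∨ lo = 2) (hF : IsFlow ends s t F k)
    (hh : IsFlow ends s t h k) (hF' : ∀ e, -lo ≤ F e ∧ F e ≤ 2) (hh' : ∀ e, -lo ≤ h e ∧ h e ≤ 2)
    (ht : ∀ e, IsTight lo (c e) (a e) (π (ends e).2 - π (ends e).1) (F e)) :
    ∑ e, edgeCost (c e) (a e) (F e) ≤ ∑ e, edgeCost (c e) (a e) (h e) := by
  have h1 : ∑ e, (h e - F e) * (π (ends e).2 - π (ends e).1) = 0 := by
    simp only [sub_mul (h _), sum_sub_distrib, hF π, hh π, sub_self]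
  calc _ = ∑ e, (edgeCost (c e) (a e) (F e) + (h e - F e) * (π (ends e).2 - π (ends e).1)) := by
        rw [sum_add_distrib, h1, add_zero]
    _ ≤ _ := sum_le_sum fun e _ => edgeCost_le (hc e) (ha e) hlo (hF' e).1 (hF' e).2 (hh' e).1
        (hh' e).2 (ht e)

/-- The cost of a pair of edge sets, where `a e` is due if `e` is in both sets. -/
def pairCost [DecidableEq E] (c a : E → ℤ) (S₁ S₂ : Finset E) : ℤ :=
  ∑ e, (((if e ∈ S₁ then c e else 0) + if e ∈ S₂ then c e else 0) +
    if e ∈ S₁ ∧ e ∈ S₂ then a e else 0)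

/-- The flow is the sum of the two unit path flows. An edge carries two units only if it lies on
both paths, in which case the pair pays `a` as well; opposite traversals cancel and make the flow
cheaper. -/
theorem exists_flow_le_pairCost [DecidableEq E] {und : Bool} {c a : E → ℤ} (hc : ∀ e, 0 ≤ c e)
    (ha : ∀ e, 0 ≤ a e) {S₁ S₂ : Finset E} (h₁ : S₁ ∈ paths (Traverses ends und) s t)
    (h₂ : S₂ ∈ paths (Traverses ends und) s t) :
    ∃ h : E → ℤ, IsFlow ends s t h 2 ∧ (∀ e, -(cond und 2 0) ≤ h e ∧ h e ≤ 2) ∧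
      ∑ e, edgeCost (c e) (a e) (h e) ≤ pairCost c a S₁ S₂ := by
  obtain ⟨p₁, hp₁, hn₁, rfl⟩ := h₁
  obtain ⟨p₂, hp₂, hn₂, rfl⟩ := h₂
  obtain ⟨x, hx, hx'⟩ := hp₁.exists_isFlow hn₁
  obtain ⟨y, hy, hy'⟩ := hp₂.exists_isFlow hn₂
  refine ⟨_, hx.add hy, fun e => ?_, sum_le_sum fun e _ => ?_⟩
  · have h1 := abs_le.1 (hx' e).1
    have h2 := abs_le.1 (hy' e).1
    have h3 := (hx' e).2.2
    have h4 := (hy' e).2.2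
    cases und
    · have := h3 rfl; have := h4 rfl
      simp only [cond_false]; omega
    · simp only [cond_true]; omega
  · obtain ⟨h1, h2, -⟩ := hx' e
    obtain ⟨k1, k2, -⟩ := hy' e
    rw [← List.mem_toFinset] at h2 k2
    rw [abs_le] at h1 k1
    have := hc e
    have := ha e
    obtain ⟨h1, h1'⟩ := h1
    obtain ⟨k1, k1'⟩ := k1
    unfold edgeCost
    generalize x e = x at *
    generalize y e = y at *
    generalize c e = c at *
    generalize a e = a at *
    by_cases he : e ∈ (p₁.map Prod.fst).toFinset <;> by_cases he' : e ∈ (p₂.map Prod.fst).toFinset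
    · simp only [he, he']
      interval_cases x <;> interval_cases y <;> norm_num <;> linarith
    · obtain rfl := k2 he'
      simp only [he, he']
      interval_cases x <;> norm_num <;> linarith
    · obtain rfl := h2 he
      simp only [he, he']
      interval_cases y <;> norm_num <;> linarith
    · obtain rfl := k2 he'
      obtain rfl := h2 he
      simp [he, he']

/-- The sets use each edge at most as often as the flow does; unused flow, such as a leftover
circulation, has nonnegative cost. -/
theorem pairCost_le [DecidableEq E] {c a F : E → ℤ} (hc : ∀ e, 0 ≤ c e) (ha : ∀ e, 0 ≤ a e)
    {S₁ S₂ : Finset E} (hF : ∀ e, |F e| ≤ 2)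
    (h : ∀ e, (if e ∈ S₁ then 1 else 0) + (if e ∈ S₂ then 1 else 0) ≤ |F e|) :
    pairCost c a S₁ S₂ ≤ ∑ e, edgeCost (c e) (a e) (F e) := by
  refine sum_le_sum fun e _ => ?_
  have h1 := h e
  have h2 := hF e
  have := hc e
  have := ha e
  unfold edgeCost
  generalize |F e| = z at *
  by_cases he : e ∈ S₁ <;> by_cases he' : e ∈ S₂ <;> simp only [he, he', if_true, if_false] at h1 ⊢
  · obtain rfl : z = 2 := by omega
    norm_num; linarith
  all_goals
    norm_num at h1 ⊢
    split_ifs <;> nlinarith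

/-- If the edge sets `S₁` and `S₂` are contained in an optimal flow of value two, then no pair of
paths is cheaper. -/
theorem pairCost_le_of_isTight [DecidableEq E] {und : Bool} {c a F : E → ℤ} {π : V → ℤ}
    (hc : ∀ e, 0 ≤ c e) (ha : ∀ e, 0 ≤ a e) (hF : IsFlow ends s t F 2)
    (hF' : ∀ e, -(cond und 2 0) ≤ F e ∧ F e ≤ 2)
    (ht : ∀ e, IsTight (cond und 2 0) (c e) (a e) (π (ends e).2 - π (ends e).1) (F e))
    {S₁ S₂ T₁ T₂ : Finset E}
    (h : ∀ e, (if e ∈ S₁ then 1 else 0) + (if e ∈ S₂ then 1 else 0) ≤ |F e|)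
    (h₁ : T₁ ∈ paths (Traverses ends und) s t) (h₂ : T₂ ∈ paths (Traverses ends und) s t) :
    pairCost c a S₁ S₂ ≤ pairCost c a T₁ T₂ := by
  obtain ⟨g, hg, hg', hle⟩ := exists_flow_le_pairCost hc ha h₁ h₂
  refine (pairCost_le hc ha (fun e => ?_) h).trans
    ((sum_edgeCost_le hc ha ?_ hF hg hF' hg' ht).trans hle)
  · have := hF' e
    rw [abs_le]
    cases und <;> simp only [cond_true, cond_false] at this <;> omega
  · cases und <;> simp

end Flow

/-! ### Clearing denominators in the objective -/

/-- Both cost vectors are scaled by the same factor, so for positive `D` integral and rational costs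
have the same minimizers. -/
theorem objective_diagonal {m : ℕ} (a c : Fin m → ℚ) {D : ℚ} (A C : Fin m → ℤ)
    (hA : ∀ e, (A e : ℚ) = a e * D) (hC : ∀ e, (C e : ℚ) = c e * D) (S₁ S₂ : Finset (Fin m)) :
    (pairCost C A S₁ S₂ : ℚ) = objective (Matrix.diagonal a) c c S₁ S₂ * D := by
  have h1 : ∑ i ∈ S₁, ∑ j ∈ S₂, Matrix.diagonal a i j =
      ∑ e, if e ∈ S₁ ∧ e ∈ S₂ then a e else 0 := by
    simp only [Matrix.diagonal_apply, sum_ite_eq]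
    rw [← sum_filter, ← sum_filter]
    exact sum_congr (by ext; simp) fun _ _ => rfl
  have h2 : ∀ S : Finset (Fin m), ∑ i ∈ S, c i = ∑ e, if e ∈ S then c e else 0 := by
    intro S
    simp
  unfold pairCost objective
  rw [h1, h2, h2, ← sum_add_distrib, ← sum_add_distrib, sum_mul]
  push_cast
  refine sum_congr rfl fun e _ => ?_
  rw [add_mul, add_mul, hA, hC]
  simp only [ite_mul, zero_mul]
  ring

end COPIC

/-! ### Array updates -/

namespace RAM

theorem Arrays.set_same (S : Arrays) (k : Fin 14) (i x : ℤ) :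
    S.set k i x k = Function.update (S k) i x := by
  funext j
  simp [Arrays.set, Function.update_apply]

theorem Arrays.set_of_ne (S : Arrays) {k k' : Fin 14} (h : k' ≠ k) (i x : ℤ) :
    S.set k i x k' = S k' := by
  funext j
  simp [Arrays.set, h]

end RAM

namespace COPIC

open RAM Finset

/-! ### Searching a network

The arrays are used as follows: `0`, `1`, `2`, `3`, `4` hold for each arc its tail, its head,
whether it can be used (if positive), its length, and whether it is on the path found; `5`, `6`, `7`
hold for each vertex when it was reached (if positive), the arc by which it was reached, and its
potential; `8`, `9`, `10` hold for each edge its two costs and its flow; `11` holds auxiliary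
scalars and `12` the output. -/

/-- The reduced length of an arc. -/
def slack (S : Arrays) (r : ℤ) : ℤ := S 3 r + S 7 (S 0 r) - S 7 (S 1 r)

/-- The usable arc `r` leads from a vertex that has been reached to one that has not. -/
def Leaves (S : Arrays) (r : ℤ) : Prop := 0 < S 2 r ∧ 0 < S 5 (S 0 r) ∧ ¬ 0 < S 5 (S 1 r)

/-- Compare an arc with the best arc found so far. -/
def scanArc : Cmd :=
  .ite (.arr 2 (.ctr 1)) (.ite (.arr 5 (.arr 0 (.ctr 1)))
    (.ite (.arr 5 (.arr 1 (.ctr 1))) .skip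
      (.seq (.set 11 (.const 2) (.sub (.add (.arr 3 (.ctr 1)) (.arr 7 (.arr 0 (.ctr 1))))
          (.arr 7 (.arr 1 (.ctr 1)))))
        (.ite (.arr 11 (.const 0))
          (.ite (.sub (.arr 11 (.const 1)) (.arr 11 (.const 2)))
            (.seq (.set 11 (.const 0) (.add (.ctr 1) (.const 1)))
              (.set 11 (.const 1) (.arr 11 (.const 2))))
            .skip)
          (.seq (.set 11 (.const 0) (.add (.ctr 1) (.const 1)))
            (.set 11 (.const 1) (.arr 11 (.const 2)))))))
    .skip) .skip

/-- Find an arc of minimum reduced length among those that leave the set of reached vertices. -/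
def scanArcs : Cmd := .loop 2 true scanArc

/-- Entry `0` of array `11` is the best arc plus one, so that `0` can mean that none was found;
entry `1` is its reduced length and entry `2` is scratch. The arrays consulted are never written, so
all comparisons refer to `S`. -/
theorem run_scanArcs {P : ℤ → ℤ} {m : ℕ} (hm : P 2 = m) {env : ℕ → ℤ} {S T : Arrays}
    (h0 : S 11 0 = 0) (hT : scanArcs.run P 1 env S = T) :
    (∀ k, k ≠ 11 → T k = S k) ∧
      (T 11 0 = 0 ∧ (∀ r : ℤ, 0 ≤ r → r < 2 * m → ¬ Leaves S r) ∨
        0 < T 11 0 ∧ T 11 0 ≤ 2 * m ∧ Leaves S (T 11 0 - 1) ∧ T 11 1 = slack S (T 11 0 - 1) ∧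
          ∀ r : ℤ, 0 ≤ r → r < 2 * m → Leaves S r → T 11 1 ≤ slack S r) := by
  subst hT
  have := Cmd.loop_invariant (P := P) (c := 2) (b := true) (d := 1) (env := env) (S := S)
    (n := 2 * m)
    (fun i T => (∀ k, k ≠ 11 → T k = S k) ∧
      (T 11 0 = 0 ∧ (∀ r : ℤ, 0 ≤ r → r < (i : ℤ) → ¬ Leaves S r) ∨
        0 < T 11 0 ∧ T 11 0 ≤ i ∧ Leaves S (T 11 0 - 1) ∧ T 11 1 = slack S (T 11 0 - 1) ∧
          ∀ r : ℤ, 0 ≤ r → r < (i : ℤ) → Leaves S r → T 11 1 ≤ slack S r))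
    (by simp [hm]) ⟨fun _ _ => rfl, .inl ⟨h0, fun r h h' => by push_cast at h'; omega⟩⟩
    (p := scanArc) ?_
  · simpa only [scanArcs, Nat.cast_mul, Nat.cast_ofNat] using this
  · rintro i - T ⟨hf, hb⟩
    have hstep : ∀ r : ℤ, r < ((i + 1 : ℕ) : ℤ) → r < i ∨ r = i := fun r h => by omega
    have e0 := hf 0 (by decide)
    have e1 := hf 1 (by decide)
    have e2 := hf 2 (by decide)
    have e3 := hf 3 (by decide)
    have e5 := hf 5 (by decide)
    have e7 := hf 7 (by decide)
    simp only [scanArc, Cmd.run, Ex.eval, Function.update_self, e0, e1, e2, e3, e5, e7]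
    have hno : ¬ Leaves S i → (∀ k, k ≠ 11 → T k = S k) ∧
      (T 11 0 = 0 ∧ (∀ r : ℤ, 0 ≤ r → r < ((i + 1 : ℕ) : ℤ) → ¬ Leaves S r) ∨
        0 < T 11 0 ∧ T 11 0 ≤ ((i + 1 : ℕ) : ℤ) ∧ Leaves S (T 11 0 - 1) ∧
          T 11 1 = slack S (T 11 0 - 1) ∧
          ∀ r : ℤ, 0 ≤ r → r < ((i + 1 : ℕ) : ℤ) → Leaves S r → T 11 1 ≤ slack S r) := by
      intro h
      refine ⟨hf, ?_⟩
      rcases hb with ⟨h1, h2⟩ | ⟨h1, h2, h3, h4, h5⟩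
      · refine .inl ⟨h1, fun r hr hr' => ?_⟩
        rcases hstep r hr' with h' | rfl
        exacts [h2 r hr h', h]
      · refine .inr ⟨h1, by omega, h3, h4, fun r hr hr' hl => ?_⟩
        rcases hstep r hr' with h' | rfl
        exacts [h5 r hr h' hl, absurd hl h]
    by_cases h1 : 0 < S 2 i
    case neg => simpa only [ifPos, h1, if_false] using hno fun h => h1 h.1
    by_cases h2 : 0 < S 5 (S 0 i)
    case neg => simpa only [ifPos, h1, h2, if_true, if_false] using hno fun h => h2 h.2.1
    by_cases h3 : 0 < S 5 (S 1 i)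
    case pos => simpa only [ifPos, h1, h2, h3, if_true] using hno fun h => h.2.2 h3
    · simp only [ifPos, h1, h2, h3, if_true, if_false]
      have hl : Leaves S i := ⟨h1, h2, h3⟩
      have hs : S 3 i + S 7 (S 0 i) - S 7 (S 1 i) = slack S i := rfl
      have hl' : Leaves S (i + 1 - 1) := by simpa using hl
      have hs' : slack S (i + 1 - 1) = slack S i := by simp
      simp only [Arrays.set_same, hs, Function.update_apply, Int.reduceEq, reduceIte]
      split_ifs with h4 h5
      · refine ⟨fun k hk => by simp only [Arrays.set_of_ne _ hk, hf k hk], .inr ?_⟩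
        simp only [Arrays.set_same, Function.update_apply, Int.reduceEq, reduceIte]
        refine ⟨by omega, by omega, hl', hs'.symm, fun r hr hr' hlr => ?_⟩
        rcases hstep r hr' with h' | rfl
        · rcases hb with ⟨hb, -⟩ | ⟨-, -, -, -, hb⟩
          · omega
          · have := hb r hr h' hlr
            omega
        · exact le_rfl
      · refine ⟨fun k hk => by simp only [Arrays.set_of_ne _ hk, hf k hk], .inr ?_⟩
        simp only [Arrays.set_same, Function.update_apply, Int.reduceEq, reduceIte]
        rcases hb with ⟨hb, -⟩ | ⟨-, hb1, hb2, hb3, hb⟩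
        · omega
        refine ⟨h4, by omega, hb2, hb3, fun r hr hr' hlr => ?_⟩
        rcases hstep r hr' with h' | rfl
        · exact hb r hr h' hlr
        · omega
      · refine ⟨fun k hk => by simp only [Arrays.set_of_ne _ hk, hf k hk], .inr ?_⟩
        simp only [Arrays.set_same, Function.update_apply, Int.reduceEq, reduceIte]
        refine ⟨by omega, by omega, hl', hs'.symm, fun r hr hr' hlr => ?_⟩
        rcases hstep r hr' with h' | rfl
        · rcases hb with ⟨-, hb⟩ | ⟨hb, -⟩
          · exact absurd hlr (hb r hr h')
          · omega
        · exact le_rfl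

/-- Increase the potential of a vertex that has not been reached. -/
def raisePotential : Cmd :=
  .ite (.arr 5 (.ctr 1)) .skip
    (.set 7 (.ctr 1) (.add (.arr 7 (.ctr 1)) (.arr 11 (.const 1))))

/-- Increase the potential of all vertices that have not been reached. -/
def raisePotentials : Cmd :=
  .loop 1 false raisePotential

theorem run_raisePotentials {P : ℤ → ℤ} {n : ℕ} (hn : P 1 = n) {env : ℕ → ℤ} {S T : Arrays}
    (hT : raisePotentials.run P 1 env S = T) :
    (∀ k, k ≠ 7 → T k = S k) ∧
      ∀ v : ℤ, 0 ≤ v → v < n → T 7 v = if 0 < S 5 v then S 7 v else S 7 v + S 11 1 := by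
  subst hT
  have := Cmd.loop_invariant (P := P) (c := 1) (b := false) (d := 1) (env := env) (S := S)
    (n := n)
    (fun i T => (∀ k, k ≠ 7 → T k = S k) ∧ (∀ v, (i : ℤ) ≤ v → T 7 v = S 7 v) ∧
      ∀ v, 0 ≤ v → v < (i : ℤ) → T 7 v = if 0 < S 5 v then S 7 v else S 7 v + S 11 1)
    (by simp [hn]) ⟨fun _ _ => rfl, fun _ _ => rfl, fun v h h' => by push_cast at h'; omega⟩
    (p := raisePotential) ?_
  · exact ⟨this.1, this.2.2⟩
  · rintro i - T ⟨hf, hr, hv⟩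
    have hstep : ∀ r : ℤ, r < ((i + 1 : ℕ) : ℤ) → r < i ∨ r = i := fun r h => by omega
    simp only [raisePotential, Cmd.run, Ex.eval, Function.update_self, hf 5 (by decide),
      hf 11 (by decide)]
    unfold ifPos
    split_ifs with h
    · refine ⟨hf, fun v hv' => hr v (by push_cast at hv'; omega), fun v hv0 hv' => ?_⟩
      rcases hstep v hv' with h' | rfl
      · exact hv v hv0 h'
      · rw [if_pos h, hr _ le_rfl]
    · refine ⟨fun k hk => by rw [Arrays.set_of_ne _ hk, hf k hk], fun v hv' => ?_,
        fun v hv0 hv' => ?_⟩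
      · rw [Arrays.set_same, Function.update_of_ne (by push_cast at hv'; omega)]
        exact hr v (by push_cast at hv'; omega)
      · rw [Arrays.set_same]
        rcases hstep v hv' with h' | rfl
        · rw [Function.update_of_ne (by omega), hv v hv0 h']
        · rw [if_neg h, Function.update_self, hr _ le_rfl]

/-- Reach one more vertex, if possible. -/
def searchStep : Cmd :=
  .seq (.set 11 (.const 0) (.const 0)) (.seq scanArcs (.ite (.arr 11 (.const 0))
    (.seq raisePotentials
      (.seq (.set 6 (.arr 1 (.sub (.arr 11 (.const 0)) (.const 1)))
          (.sub (.arr 11 (.const 0)) (.const 1)))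
        (.set 5 (.arr 1 (.sub (.arr 11 (.const 0)) (.const 1))) (.add (.ctr 0) (.const 2)))))
    .skip))

/-- Search the network from the first terminal, as in Dijkstra's algorithm. -/
def search : Cmd :=
  .seq (.loop 1 false (.set 5 (.ctr 0) (.const 0)))
    (.seq (.set 5 (.inp (.const 3)) (.const 1)) (.loop 1 false searchStep))

/-- The arcs of the network have their ends among the vertices. -/
def ValidArcs (n m : ℕ) (S : Arrays) : Prop :=
  ∀ r : ℤ, 0 ≤ r → r < 2 * (m : ℤ) → (0 ≤ S 0 r ∧ S 0 r < n) ∧ (0 ≤ S 1 r ∧ S 1 r < n)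

/-- Usable arcs have nonnegative reduced lengths. -/
def Feasible (m : ℕ) (S : Arrays) : Prop :=
  ∀ r : ℤ, 0 ≤ r → r < 2 * (m : ℤ) → 0 < S 2 r → 0 ≤ slack S r

/-- No usable arc leads out of the set of vertices that have been reached. -/
def Closed (m : ℕ) (S : Arrays) : Prop :=
  ∀ r : ℤ, 0 ≤ r → r < 2 * (m : ℤ) → ¬ Leaves S r

/-- The vertices that have been reached form a tree with root `s`; its arcs have reduced length
zero if `Q` holds. -/
structure IsTree (n m : ℕ) (s : ℤ) (Q : Prop) (k : ℕ) (S : Arrays) : Prop where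
  root : S 5 s = 1
  bound : ∀ v : ℤ, 0 ≤ v → v < n → 0 ≤ S 5 v ∧ S 5 v ≤ k + 1
  parent : ∀ v : ℤ, 0 ≤ v → v < n → 0 < S 5 v → v ≠ s →
    (0 ≤ S 6 v ∧ S 6 v < 2 * m) ∧ 0 < S 2 (S 6 v) ∧ S 1 (S 6 v) = v ∧
      0 < S 5 (S 0 (S 6 v)) ∧ S 5 (S 0 (S 6 v)) < S 5 v ∧ (Q → slack S (S 6 v) = 0)
  feasible : Q → Feasible m S

theorem slack_congr {S T : Arrays} (h0 : T 0 = S 0) (h1 : T 1 = S 1) (h3 : T 3 = S 3)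
    (h7 : T 7 = S 7) : slack T = slack S := by
  unfold slack
  rw [h0, h1, h3, h7]

theorem Leaves_congr {S T : Arrays} (h0 : T 0 = S 0) (h1 : T 1 = S 1) (h2 : T 2 = S 2)
    (h5 : T 5 = S 5) : Leaves T = Leaves S := by
  unfold Leaves
  rw [h0, h1, h2, h5]

theorem IsTree.congr {n m k : ℕ} {s : ℤ} {Q : Prop} {S T : Arrays} (ht : IsTree n m s Q k S)
    (h0 : T 0 = S 0) (h1 : T 1 = S 1) (h2 : T 2 = S 2) (h3 : T 3 = S 3) (h5 : T 5 = S 5)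
    (h6 : T 6 = S 6) (h7 : T 7 = S 7) : IsTree n m s Q (k + 1) T := by
  obtain ⟨t1, t2, t3, t4⟩ := ht
  unfold Feasible at t4
  refine ⟨by rwa [h5], fun v hv hv' => ?_, ?_, ?_⟩
  · have := t2 v hv hv'
    rw [h5]
    push_cast
    omega
  · rwa [h5, h6, h2, h1, h0, slack_congr h0 h1 h3 h7]
  · unfold Feasible
    rwa [slack_congr h0 h1 h3 h7, h2]

/-- Dijkstra's step in terms of potentials. Raising all unreached vertices by the minimum reduced
length of the leaving arcs makes the chosen arc tight, and minimality keeps the other leaving arcs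
nonnegative. The label `k + 2` exceeds all earlier ones, which are at most `k + 1`, so labels
decrease towards the root. -/
theorem IsTree.step {n m k : ℕ} {s : ℤ} {Q : Prop} {S T : Arrays} {r₀ : ℤ} (hv : ValidArcs n m S)
    (ht : IsTree n m s Q k S)
    (h0 : T 0 = S 0) (h1 : T 1 = S 1) (h2 : T 2 = S 2) (h3 : T 3 = S 3)
    (h5 : T 5 = Function.update (S 5) (S 1 r₀) (k + 2)) (h6 : T 6 = Function.update (S 6) (S 1 r₀) r₀)
    (h7 : ∀ v : ℤ, 0 ≤ v → v < n → T 7 v = if 0 < S 5 v then S 7 v else S 7 v + slack S r₀)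
    (hr : 0 ≤ r₀) (hr' : r₀ < 2 * m) (hl : Leaves S r₀)
    (hmin : ∀ r : ℤ, 0 ≤ r → r < 2 * m → Leaves S r → slack S r₀ ≤ slack S r) :
    IsTree n m s Q (k + 1) T := by
  obtain ⟨t1, t2, t3, t4⟩ := ht
  obtain ⟨l1, l2, l3⟩ := hl
  have hsw : S 1 r₀ ≠ s := by
    rintro rfl
    omega
  have hT5 : ∀ v, 0 < S 5 v → T 5 v = S 5 v := by
    intro v hv
    rw [h5, Function.update_of_ne]
    rintro rfl
    exact l3 hv
  -- Only arcs between reached and unreached vertices change: leaving arcs lose the minimum,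
  -- entering arcs gain it. Tree arcs join reached vertices and stay tight.
  have hslack : ∀ r : ℤ, 0 ≤ r → r < 2 * m → slack T r = slack S r +
      ((if 0 < S 5 (S 0 r) then 0 else slack S r₀) - if 0 < S 5 (S 1 r) then 0 else slack S r₀) := by
    intro r hr hr'
    obtain ⟨v1, v2⟩ := hv r hr hr'
    conv_lhs => unfold slack
    rw [h0, h1, h3, h7 _ v1.1 v1.2, h7 _ v2.1 v2.2]
    conv_rhs => rw [slack]
    split_ifs <;> ring
  refine ⟨?_, fun v hv0 hv' => ?_, fun v hv0 hv' hpos hvs => ?_, fun q r hr0 hr1 hact => ?_⟩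
  · rw [hT5 s (by omega), t1]
  · have := t2 v hv0 hv'
    rw [h5, Function.update_apply]
    split_ifs <;> push_cast <;> omega
  · rw [h0, h1, h2]
    rcases eq_or_ne v (S 1 r₀) with rfl | hvw
    · have := hv r₀ hr hr'
      have := t2 (S 0 r₀) this.1.1 this.1.2
      rw [h6, Function.update_self, hslack r₀ hr hr', if_pos l2, if_neg l3, hT5 _ l2, h5,
        Function.update_self]
      exact ⟨⟨hr, hr'⟩, l1, rfl, l2, by omega, fun _ => by ring⟩
    · rw [h6, Function.update_of_ne hvw]
      rw [h5, Function.update_of_ne hvw] at hpos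
      obtain ⟨p1, p2, p3, p4, p5, p6⟩ := t3 v hv0 hv' hpos hvs
      rw [hslack _ p1.1 p1.2, hT5 _ p4, hT5 _ hpos, p3, if_pos p4, if_pos hpos]
      exact ⟨p1, p2, rfl, p4, p5, fun q => by simpa using p6 q⟩
  · rw [h2] at hact
    have f1 := t4 q r hr0 hr1 hact
    have f2 := t4 q r₀ hr hr' l1
    have f3 := hmin r hr0 hr1
    unfold Leaves at f3
    rw [hslack r hr0 hr1]
    split_ifs with c1 c2 c2
    · simpa using f1
    · have := f3 ⟨hact, c1, c2⟩
      omega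
    · omega
    · simpa using f1

/-- Either the scan finds no leaving arc and the reached set is already closed, or exactly one new
vertex is labelled. This dichotomy is the progress measure for `run_search`. -/
theorem run_searchStep {P : ℤ → ℤ} {n m : ℕ} (hn : P 1 = n) (hm : P 2 = m) {s : ℤ} {Q : Prop}
    {env : ℕ → ℤ} {k : ℕ} {S T : Arrays} (hv : ValidArcs n m S) (ht : IsTree n m s Q k S)
    (hT : searchStep.run P 1 (Function.update env 0 (k : ℤ)) S = T) :
    (∀ k, k ≠ 5 → k ≠ 6 → k ≠ 7 → k ≠ 11 → T k = S k) ∧ IsTree n m s Q (k + 1) T ∧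
      (Closed m S → Closed m T) ∧
      (¬ Closed m S → ∃ v : ℤ, 0 ≤ v ∧ v < n ∧ ¬ 0 < S 5 v ∧ 0 < T 5 v ∧
        ∀ u, u ≠ v → T 5 u = S 5 u) := by
  simp only [searchStep, Cmd.run, Ex.eval] at hT
  set S1 := S.set 11 0 0 with hS1
  have e1 : ∀ k, k ≠ 11 → S1 k = S k := fun k hk => Arrays.set_of_ne _ hk _ _
  set S2 := scanArcs.run P 1 (Function.update env 0 (k : ℤ)) S1 with hS2
  obtain ⟨e2, hscan⟩ := run_scanArcs hm (by rw [hS1, Arrays.set_same, Function.update_self])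
    hS2.symm
  have e2 : ∀ k, k ≠ 11 → S2 k = S k := fun k hk => (e2 k hk).trans (e1 k hk)
  rw [slack_congr (e1 0 (by decide)) (e1 1 (by decide)) (e1 3 (by decide)) (e1 7 (by decide)),
    Leaves_congr (e1 0 (by decide)) (e1 1 (by decide)) (e1 2 (by decide)) (e1 5 (by decide))]
    at hscan
  rcases hscan with ⟨hb, hcl⟩ | ⟨hb, hb', hl, hd, hmin⟩
  · rw [hb, ifPos, if_neg (lt_irrefl _)] at hT
    subst hT
    refine ⟨fun k _ _ _ hk => e2 k hk, ht.congr (e2 0 (by decide)) (e2 1 (by decide))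
      (e2 2 (by decide)) (e2 3 (by decide)) (e2 5 (by decide)) (e2 6 (by decide))
      (e2 7 (by decide)), fun _ => ?_, fun h => absurd hcl h⟩
    unfold Closed
    rwa [Leaves_congr (e2 0 (by decide)) (e2 1 (by decide)) (e2 2 (by decide)) (e2 5 (by decide))]
  · rw [ifPos, if_pos hb] at hT
    obtain ⟨e3, h7⟩ := run_raisePotentials (env := Function.update env 0 (k : ℤ)) (S := S2) hn rfl
    set S3 := raisePotentials.run P 1 (Function.update env 0 (k : ℤ)) S2
    rw [e2 5 (by decide), e2 7 (by decide), hd] at h7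
    have e11 : S3 11 = S2 11 := e3 11 (by decide)
    have ea1 : S3 1 = S 1 := (e3 1 (by decide)).trans (e2 1 (by decide))
    simp only [Arrays.set_of_ne _ (show (11 : Fin 14) ≠ 6 by decide),
      Arrays.set_of_ne _ (show (1 : Fin 14) ≠ 6 by decide), e11, ea1, Function.update_self] at hT
    set r₀ := S2 11 0 - 1 with hr₀
    have hfr : ∀ k, k ≠ 5 → k ≠ 6 → k ≠ 7 → k ≠ 11 → T k = S k := by
      intro k h5 h6 h7 h11
      rw [← hT, Arrays.set_of_ne _ h5, Arrays.set_of_ne _ h6, e3 k h7, e2 k h11]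
    have h5 : T 5 = Function.update (S 5) (S 1 r₀) (k + 2) := by
      rw [← hT, Arrays.set_same, Arrays.set_of_ne _ (by decide), e3 _ (by decide),
        e2 _ (by decide)]
    have h6 : T 6 = Function.update (S 6) (S 1 r₀) r₀ := by
      rw [← hT, Arrays.set_of_ne _ (by decide), Arrays.set_same, e3 _ (by decide),
        e2 _ (by decide)]
    have h7' : T 7 = S3 7 := by
      rw [← hT, Arrays.set_of_ne _ (by decide), Arrays.set_of_ne _ (by decide)]
    refine ⟨hfr, ht.step hv (hfr 0 (by decide) (by decide) (by decide) (by decide))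
      (hfr 1 (by decide) (by decide) (by decide) (by decide))
      (hfr 2 (by decide) (by decide) (by decide) (by decide))
      (hfr 3 (by decide) (by decide) (by decide) (by decide)) h5 h6 (by rwa [h7'])
      (by omega) (by omega) hl (by rwa [hd] at hmin), fun h => absurd hl (h _ (by omega) (by omega)),
      fun _ => ?_⟩
    have hw := (hv r₀ (by omega) (by omega)).2
    refine ⟨S 1 r₀, hw.1, hw.2, hl.2.2, ?_, fun u hu => ?_⟩
    · rw [h5, Function.update_self]
      omega
    · rw [h5, Function.update_of_ne hu]

theorem run_search {P : ℤ → ℤ} {n m : ℕ} (hn : P 1 = n) (hm : P 2 = m) (hs : 0 ≤ P 3)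
    (hsn : P 3 < n) {Q : Prop} {env : ℕ → ℤ} {S T : Arrays} (hv : ValidArcs n m S)
    (hQ : Q → Feasible m S) (hT : search.run P 0 env S = T) :
    (∀ k, k ≠ 5 → k ≠ 6 → k ≠ 7 → k ≠ 11 → T k = S k) ∧ IsTree n m (P 3) Q n T ∧ Closed m T := by
  simp only [search, Cmd.run.eq_3, Cmd.run.eq_2, Ex.eval] at hT
  have hclear := Cmd.loop_invariant (P := P) (c := 1) (b := false) (d := 0) (env := env) (S := S)
    (n := n) (p := .set 5 (.ctr 0) (.const 0))
    (fun i T => (∀ k, k ≠ 5 → T k = S k) ∧ ∀ v : ℤ, 0 ≤ v → v < (i : ℤ) → T 5 v = 0)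
    (by simp [hn]) ⟨fun _ _ => rfl, fun v h h' => by push_cast at h'; omega⟩ (by
      rintro i - T ⟨h1, h2⟩
      simp only [Cmd.run, Ex.eval, Function.update_self]
      refine ⟨fun k hk => by rw [Arrays.set_of_ne _ hk, h1 k hk], fun v hv hv' => ?_⟩
      rw [Arrays.set_same, Function.update_apply]
      split_ifs with h
      · rfl
      · exact h2 v hv (by push_cast at hv'; omega))
  set S1 := (Cmd.loop 1 false (.set 5 (.ctr 0) (.const 0))).run P 0 env S
  obtain ⟨e1, h1⟩ := hclear
  set S2 := S1.set 5 (P 3) 1 with hS2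
  have e2 : ∀ k, k ≠ 5 → S2 k = S k := fun k hk => by rw [hS2, Arrays.set_of_ne _ hk, e1 k hk]
  have h2 : S2 5 = Function.update (S1 5) (P 3) 1 := by rw [hS2, Arrays.set_same]
  -- While the reached set is not closed, at least `i + 1` vertices have been reached after `i`
  -- rounds. After `n` rounds that would exceed the number of vertices.
  have hloop := Cmd.loop_invariant (P := P) (c := 1) (b := false) (d := 0) (env := env) (S := S2)
    (n := n) (p := searchStep)
    (fun i T => (∀ k, k ≠ 5 → k ≠ 6 → k ≠ 7 → k ≠ 11 → T k = S k) ∧ IsTree n m (P 3) Q i T ∧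
      (Closed m T ∨ i + 1 ≤ #((range n).filter fun v : ℕ => 0 < T 5 (v : ℤ))))
    (by simp [hn]) ?_ ?_
  · rw [hT] at hloop
    obtain ⟨h1, h2, h3⟩ := hloop
    refine ⟨h1, h2, h3.resolve_right fun h => ?_⟩
    have := (card_filter_le (range n) fun v : ℕ => 0 < T 5 (v : ℤ))
    rw [card_range] at this
    omega
  · refine ⟨fun k hk _ _ _ => e2 k hk, ⟨by rw [h2, Function.update_self], fun v hv hv' => ?_,
      fun v hv hv' hpos hvs => ?_, fun q => ?_⟩, .inr ?_⟩
    · rw [h2, Function.update_apply, h1 v hv hv']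
      split_ifs <;> simp
    · rw [h2, Function.update_of_ne hvs, h1 v hv hv'] at hpos
      omega
    · have := hQ q
      unfold Feasible at this ⊢
      rwa [slack_congr (e2 0 (by decide)) (e2 1 (by decide)) (e2 3 (by decide)) (e2 7 (by decide)),
        e2 2 (by decide)]
    · rw [zero_add, Nat.one_le_iff_ne_zero, ← Nat.pos_iff_ne_zero, card_pos]
      refine ⟨(P 3).toNat, mem_filter.2 ⟨mem_range.2 ((Int.toNat_lt hs).2 hsn), ?_⟩⟩
      rw [Int.toNat_of_nonneg hs, h2, Function.update_self]
      omega
  · rintro i - T ⟨f1, f2, f3⟩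
    have hv' : ValidArcs n m T := by
      unfold ValidArcs
      rwa [f1 0 (by decide) (by decide) (by decide) (by decide),
        f1 1 (by decide) (by decide) (by decide) (by decide)]
    obtain ⟨g1, g2, g3, g4⟩ := run_searchStep hn hm (env := env) hv' f2 rfl
    refine ⟨fun k h5 h6 h7 h11 => (g1 k h5 h6 h7 h11).trans (f1 k h5 h6 h7 h11), g2, ?_⟩
    by_cases hc : Closed m T
    · exact .inl (g3 hc)
    · have f3 := f3.resolve_left hc
      obtain ⟨v, v1, v2, v3, v4, v5⟩ := g4 hc
      refine .inr (Nat.succ_le_of_lt (lt_of_le_of_lt f3 (card_lt_card ?_)))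
      rw [Finset.ssubset_iff_of_subset]
      · refine ⟨v.toNat, ?_, ?_⟩
        · rw [mem_filter, mem_range, Int.toNat_of_nonneg v1]
          exact ⟨by omega, v4⟩
        · rw [mem_filter, Int.toNat_of_nonneg v1]
          exact fun h => v3 h.2
      · intro u hu
        rw [mem_filter] at hu ⊢
        refine ⟨hu.1, ?_⟩
        rcases eq_or_ne (u : ℤ) v with h | h
        · rwa [h]
        · rw [v5 _ h]
          exact hu.2

/-! ### Networks with paired arcs and paths in the search tree -/

/-- The arcs `2 e` and `2 e + 1` are the two orientations of the edge `e`. -/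
def IsNetwork {n m : ℕ} (ends : Fin m → Fin n × Fin n) (S : Arrays) : Prop :=
  ∀ e : Fin m, S 0 (2 * (e : ℕ)) = ((ends e).1 : ℕ) ∧ S 1 (2 * (e : ℕ)) = ((ends e).2 : ℕ) ∧
    S 0 (2 * (e : ℕ) + 1) = ((ends e).2 : ℕ) ∧ S 1 (2 * (e : ℕ) + 1) = ((ends e).1 : ℕ)

/-- One of the two arcs of the edge `e` is usable and leads from `u` to `v`. -/
def Usable {n m : ℕ} (ends : Fin m → Fin n × Fin n) (S : Arrays) (e : Fin m) (u v : Fin n) : Prop :=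
  0 < S 2 (2 * (e : ℕ)) ∧ ends e = (u, v) ∨ 0 < S 2 (2 * (e : ℕ) + 1) ∧ ends e = (v, u)

theorem exists_edge_of_arc {m : ℕ} {r : ℤ} (h : 0 ≤ r) (h' : r < 2 * m) :
    ∃ e : Fin m, r = 2 * (e : ℕ) ∨ r = 2 * (e : ℕ) + 1 := by
  refine ⟨⟨(r / 2).toNat, by omega⟩, ?_⟩
  simp only
  omega

theorem IsNetwork.validArcs {n m : ℕ} {ends : Fin m → Fin n × Fin n} {S : Arrays}
    (h : IsNetwork ends S) : ValidArcs n m S := by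
  intro r hr hr'
  obtain ⟨e, he⟩ := exists_edge_of_arc hr hr'
  obtain ⟨h1, h2, h3, h4⟩ := h e
  have := (ends e).1.isLt
  have := (ends e).2.isLt
  rcases he with rfl | rfl
  · rw [h1, h2]; omega
  · rw [h3, h4]; omega

/-- Move one step back on the path. -/
def traceStep : Cmd :=
  .ite (.sub (.arr 5 (.arr 11 (.const 2))) (.const 1))
    (.seq (.set 4 (.arr 6 (.arr 11 (.const 2))) (.const 1))
      (.set 11 (.const 2) (.arr 0 (.arr 6 (.arr 11 (.const 2))))))
    .skip

/-- Mark the arcs of the path in the search tree that leads to the second terminal. -/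
def trace : Cmd :=
  .seq (.loop 2 true (.set 4 (.ctr 0) (.const 0)))
    (.seq (.set 11 (.const 2) (.inp (.const 4))) (.loop 1 false traceStep))

/-- The arcs marked with `1` in `X` form a path from `u` to `t`. -/
structure IsMarkedPath {n m : ℕ} (ends : Fin m → Fin n × Fin n) (S : Arrays) (Q : Prop) (X : ℤ → ℤ)
    (u t : Fin n) (p : List (Fin m × Fin n)) : Prop where
  isWalk : IsWalk (Usable ends S) u p t
  nodup : (u :: p.map Prod.snd).Nodup
  mark : ∀ r : ℤ, 0 ≤ r → r < 2 * m → X r = 0 ∨ X r = 1 ∧ 0 < S 2 r ∧ (Q → slack S r = 0)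
  mem_iff : ∀ e : Fin m, e ∈ p.map Prod.fst ↔ X (2 * (e : ℕ)) = 1 ∨ X (2 * (e : ℕ) + 1) = 1
  isFlow : IsFlow ends u t (fun e : Fin m => X (2 * (e : ℕ)) - X (2 * (e : ℕ) + 1)) 1

theorem IsMarkedPath.cons {n m : ℕ} {ends : Fin m → Fin n × Fin n} {S : Arrays} {Q : Prop}
    {X : ℤ → ℤ} {u v t : Fin n} {p : List (Fin m × Fin n)} (h : IsMarkedPath ends S Q X v t p)
    (hu : u ∉ v :: p.map Prod.snd) {e : Fin m} {r : ℤ}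
    (hr : r = 2 * (e : ℕ) ∧ ends e = (u, v) ∨ r = 2 * (e : ℕ) + 1 ∧ ends e = (v, u))
    (hX : X r = 0) (hact : 0 < S 2 r) (hQ : Q → slack S r = 0) :
    IsMarkedPath ends S Q (Function.update X r 1) u t ((e, v) :: p) := by
  refine ⟨⟨?_, h.isWalk⟩, List.nodup_cons.2 ⟨hu, h.nodup⟩, fun r' hr0 hr1 => ?_, fun e' => ?_, ?_⟩
  · rcases hr with ⟨rfl, hr⟩ | ⟨rfl, hr⟩
    exacts [.inl ⟨hact, hr⟩, .inr ⟨hact, hr⟩]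
  · rcases eq_or_ne r' r with rfl | hne
    · rw [Function.update_self]
      exact .inr ⟨rfl, hact, hQ⟩
    · rw [Function.update_of_ne hne]
      exact h.mark r' hr0 hr1
  · rw [List.map_cons, List.mem_cons, h.mem_iff]
    rcases eq_or_ne e' e with rfl | hne
    · rcases hr with ⟨rfl, -⟩ | ⟨rfl, -⟩ <;> simp
    · have : (e' : ℕ) ≠ e := fun h => hne (Fin.ext h)
      rw [Function.update_of_ne (by omega), Function.update_of_ne (by omega)]
      simp [hne]
  -- Marking the arc `r` changes the net flow only on `e`, by one unit from `u` to `v`.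
  · have hz : ∃ z : ℤ, (z = 1 ∧ ends e = (u, v) ∨ z = -1 ∧ ends e = (v, u)) ∧
        ∀ e' : Fin m, Function.update X r 1 (2 * (e' : ℕ)) - Function.update X r 1 (2 * (e' : ℕ) + 1)
          = (if e' = e then z else 0) + (X (2 * (e' : ℕ)) - X (2 * (e' : ℕ) + 1)) := by
      rcases hr with ⟨rfl, hr⟩ | ⟨rfl, hr⟩
      · refine ⟨1, .inl ⟨rfl, hr⟩, fun e' => ?_⟩
        rw [Function.update_of_ne (show 2 * ((e' : ℕ) : ℤ) + 1 ≠ 2 * (e : ℕ) by omega)]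
        rcases eq_or_ne e' e with rfl | hne
        · simp [hX]; ring
        · have : (e' : ℕ) ≠ e := fun h => hne (Fin.ext h)
          rw [Function.update_of_ne (by omega), if_neg hne, zero_add]
      · refine ⟨-1, .inr ⟨rfl, hr⟩, fun e' => ?_⟩
        rw [Function.update_of_ne (show 2 * ((e' : ℕ) : ℤ) ≠ 2 * (e : ℕ) + 1 by omega)]
        rcases eq_or_ne e' e with rfl | hne
        · simp [hX]; ring
        · have : (e' : ℕ) ≠ e := fun h => hne (Fin.ext h)
          rw [Function.update_of_ne (by omega), if_neg hne, zero_add]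
    obtain ⟨z, hz, hz'⟩ := hz
    simp only [hz']
    exact (IsFlow.single hz).trans h.isFlow

/-- Labels decrease strictly from a vertex to its parent. Hence the vertices met are distinct, the
path is simple, and the root is reached in time. -/
theorem run_trace {P : ℤ → ℤ} {n m : ℕ} (hn : P 1 = n) (hm : P 2 = m)
    {ends : Fin m → Fin n × Fin n} {s t : Fin n} (ht : P 4 = (t : ℕ))
    {Q : Prop} {env : ℕ → ℤ} {S T : Arrays} (hv : IsNetwork ends S)
    (htree : IsTree n m (s : ℕ) Q n S) (hreach : 0 < S 5 (t : ℕ))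
    (hT : trace.run P 0 env S = T) :
    (∀ k, k ≠ 4 → k ≠ 11 → T k = S k) ∧ ∃ p, IsMarkedPath ends S Q (T 4) s t p := by
  simp only [trace, Cmd.run.eq_3, Cmd.run.eq_2, Ex.eval] at hT
  have hclear := Cmd.loop_invariant (P := P) (c := 2) (b := true) (d := 0) (env := env) (S := S)
    (n := 2 * m) (p := .set 4 (.ctr 0) (.const 0))
    (fun i T => (∀ k, k ≠ 4 → T k = S k) ∧ ∀ v : ℤ, 0 ≤ v → v < (i : ℤ) → T 4 v = 0)
    (by simp [hm]) ⟨fun _ _ => rfl, fun v h h' => by push_cast at h'; omega⟩ (by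
      rintro i - T ⟨h1, h2⟩
      simp only [Cmd.run, Ex.eval, Function.update_self]
      refine ⟨fun k hk => by rw [Arrays.set_of_ne _ hk, h1 k hk], fun v hv hv' => ?_⟩
      rw [Arrays.set_same, Function.update_apply]
      split_ifs with h
      · rfl
      · exact h2 v hv (by push_cast at hv'; omega))
  set S1 := (Cmd.loop 2 true (.set 4 (.ctr 0) (.const 0))).run P 0 env S
  obtain ⟨e1, h1⟩ := hclear
  push_cast at h1
  set S2 := S1.set 11 2 (P 4) with hS2
  -- Labels start at most at `n + 1` and drop in every round until they are `1`. Every marked arc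
  -- has a head with a larger label than the current vertex, so the next parent arc is still
  -- unmarked.
  have hloop := Cmd.loop_invariant (P := P) (c := 1) (b := false) (d := 0) (env := env) (S := S2)
    (n := n) (p := traceStep)
    (fun i T => (∀ k, k ≠ 4 → k ≠ 11 → T k = S k) ∧ ∃ v : Fin n, T 11 2 = (v : ℕ) ∧
      0 < S 5 (v : ℕ) ∧ (S 5 (v : ℕ) = 1 ∨ S 5 (v : ℕ) + i ≤ n + 1) ∧
      (∀ r : ℤ, 0 ≤ r → r < 2 * m → T 4 r = 1 → S 5 (v : ℕ) < S 5 (S 1 r)) ∧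
      ∃ p, IsMarkedPath ends S Q (T 4) v t p ∧
        ∀ w ∈ p.map Prod.snd, S 5 (v : ℕ) < S 5 ((w : Fin n) : ℕ))
    (by simp [hn]) ?_ ?_
  · rw [hT] at hloop
    obtain ⟨f1, v, -, f3, f4, -, p, f5, -⟩ := hloop
    -- The label is now `1`, and a vertex other than the root would have a parent with a label
    -- strictly between `0` and `1`.
    have hvs : v = s := by
      by_contra hne
      have hne' : ((v : ℕ) : ℤ) ≠ (s : ℕ) := fun h => hne (Fin.ext (by omega))
      obtain ⟨-, -, -, h4, h5, -⟩ := htree.parent (v : ℕ) (by omega) (by omega) f3 hne'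
      omega
    subst hvs
    exact ⟨f1, p, f5⟩
  · have h4 : S2 4 = S1 4 := by rw [hS2, Arrays.set_of_ne _ (by decide)]
    refine ⟨fun k h4 h11 => by rw [hS2, Arrays.set_of_ne _ h11, e1 k h4], t,
      by rw [hS2, Arrays.set_same, Function.update_self, ht], hreach, .inr ?_,
      fun r hr hr' h => ?_, [], ⟨rfl, by simp, fun r hr hr' => ?_, fun e => ?_, fun φ => ?_⟩,
      by simp⟩
    · have := (htree.bound (t : ℕ) (by omega) (by omega)).2
      push_cast
      omega
    · rw [h4, h1 r hr hr'] at h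
      omega
    · rw [h4, h1 r hr hr']
      exact .inl rfl
    · have := e.isLt
      rw [h4, h1 _ (by omega) (by omega), h1 _ (by omega) (by omega)]
      simp
    · rw [sub_self, mul_zero]
      refine sum_eq_zero fun e _ => ?_
      have := e.isLt
      beta_reduce
      rw [h4, h1 _ (by omega) (by omega), h1 _ (by omega) (by omega)]
      simp
  · rintro i - T ⟨f1, v, f2, f3, f4, f5, p, f6, f7⟩
    simp only [traceStep, Cmd.run, Ex.eval, Arrays.set_of_ne _ (show (0 : Fin 14) ≠ 4 by decide),
      Arrays.set_of_ne _ (show (6 : Fin 14) ≠ 4 by decide),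
      Arrays.set_of_ne _ (show (11 : Fin 14) ≠ 4 by decide), f2,
      f1 5 (by decide) (by decide), f1 6 (by decide) (by decide), f1 0 (by decide) (by decide)]
    unfold ifPos
    split_ifs with hpos
    · have hne : ((v : ℕ) : ℤ) ≠ (s : ℕ) := by
        intro h
        have := htree.root
        rw [← h] at this
        omega
      obtain ⟨g1, g2, g3, g4, g5, g6⟩ := htree.parent (v : ℕ) (by omega) (by omega) f3 hne
      set r := S 6 (v : ℕ)
      obtain ⟨e, he⟩ := exists_edge_of_arc g1.1 g1.2
      obtain ⟨u, hu, hr⟩ : ∃ u : Fin n, S 0 r = (u : ℕ) ∧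
          (r = 2 * (e : ℕ) ∧ ends e = (u, v) ∨ r = 2 * (e : ℕ) + 1 ∧ ends e = (v, u)) := by
        obtain ⟨h1, h2, h3, h4⟩ := hv e
        rcases he with he | he
        · rw [he] at g3 ⊢
          refine ⟨_, h1, .inl ⟨rfl, Prod.ext rfl (Fin.ext ?_)⟩⟩
          simp only
          omega
        · rw [he] at g3 ⊢
          refine ⟨_, h3, .inr ⟨rfl, Prod.ext (Fin.ext ?_) rfl⟩⟩
          simp only
          omega
      rw [hu] at g4 g5
      have hX : T 4 r = 0 := by
        rcases f6.mark r g1.1 g1.2 with h | ⟨h, -⟩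
        · exact h
        · have := f5 r g1.1 g1.2 h
          rw [g3] at this
          omega
      have h4 : ((T.set 4 r 1).set 11 2 (S 0 r)) 4 = Function.update (T 4) r 1 := by
        rw [Arrays.set_of_ne _ (by decide), Arrays.set_same]
      rw [h4]
      refine ⟨fun k h4 h11 => by
          rw [Arrays.set_of_ne _ h11, Arrays.set_of_ne _ h4, f1 k h4 h11], u,
        by rw [Arrays.set_same, Function.update_self, hu], g4, .inr (by push_cast; omega),
        fun r' hr0 hr1 h => ?_, (e, v) :: p, f6.cons ?_ hr hX g2 g6, ?_⟩
      · rcases eq_or_ne r' r with rfl | hne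
        · rw [g3]
          exact g5
        · rw [Function.update_of_ne hne] at h
          exact g5.trans (f5 r' hr0 hr1 h)
      · rw [List.mem_cons, not_or]
        refine ⟨fun h => ?_, fun h => ?_⟩
        · rw [h] at g5
          omega
        · have := f7 u h
          omega
      · intro w hw
        rw [List.map_cons, List.mem_cons] at hw
        rcases hw with rfl | hw
        · exact g5
        · exact g5.trans (f7 w hw)
    · exact ⟨f1, v, f2, f3, .inl (by omega), f5, p, f6, f7⟩

/-! ### The elementary loops -/

/-- A loop that changes one cell of the array `k` in each round. -/
theorem run_loop_of_set {P : ℤ → ℤ} {c : ℕ} {b : Bool} {p : Cmd} {d : ℕ} {env : ℕ → ℤ}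
    {S T : Arrays} {N : ℕ} (hN : c * (P (cond b 2 1)).toNat = N) (k : Fin 14) (g f : ℕ → ℤ)
    (hg : ∀ i j, g i = g j → i = j)
    (h : ∀ i < N, ∀ T : Arrays, (∀ k', k' ≠ k → T k' = S k') → T k (g i) = S k (g i) →
      p.run P (d + 1) (Function.update env d (i : ℤ)) T = T.set k (g i) (f i))
    (hT : (Cmd.loop c b p).run P d env S = T) :
    (∀ k', k' ≠ k → T k' = S k') ∧ (∀ i < N, T k (g i) = f i) ∧
      ∀ j, (∀ i < N, j ≠ g i) → T k j = S k j := by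
  have := Cmd.loop_invariant (P := P) (c := c) (b := b) (d := d) (env := env) (S := S) (p := p)
    (fun n T => (∀ k', k' ≠ k → T k' = S k') ∧ (∀ i < n, T k (g i) = f i) ∧
      ∀ j, (∀ i < n, j ≠ g i) → T k j = S k j) hN
    ⟨fun _ _ => rfl, fun i hi => by omega, fun _ _ => rfl⟩ (by
      rintro n hn T ⟨h1, h2, h3⟩
      -- Since `g` is injective, the cell of this round has not been written before and still has
      -- its original value.
      rw [h n hn T h1 (h3 _ fun i hi h => by have := hg _ _ h; omega)]
      refine ⟨fun k' hk => by rw [Arrays.set_of_ne _ hk, h1 k' hk], fun i hi => ?_, fun j hj => ?_⟩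
      · rw [Arrays.set_same, Function.update_apply]
        split_ifs with he
        · rw [hg _ _ he]
        · exact h2 i (lt_of_le_of_ne (by omega) fun h => he (by rw [h]))
      · rw [Arrays.set_same, Function.update_of_ne (hj n (by omega))]
        exact h3 j fun i hi => hj i (by omega))
  rwa [hT] at this

/-- The arc `2 e`, where `e` is the counter of the outermost loop. -/
def fwd : Ex := .scale 2 (.ctr 0)

/-- The arc `2 e + 1`, where `e` is the counter of the outermost loop. -/
def bwd : Ex := .add (.scale 2 (.ctr 0)) (.const 1)

/-- Let the length of the arc `r` of the edge `e` be the cost of increasing the flow `x`. -/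
def setLength (r x : Ex) : Cmd :=
  .ite x (.set 3 r (.add (.arr 8 (.ctr 0)) (.arr 9 (.ctr 0))))
    (.ite (.add x (.const 1)) (.set 3 r (.arr 8 (.ctr 0)))
      (.ite (.add x (.const 2)) (.set 3 r (.sub (.const 0) (.arr 8 (.ctr 0))))
        (.set 3 r (.sub (.const 0) (.add (.arr 8 (.ctr 0)) (.arr 9 (.ctr 0)))))))

theorem run_setLength {P : ℤ → ℤ} {d : ℕ} {env : ℕ → ℤ} {S : Arrays} {r x : Ex} :
    (setLength r x).run P d env S = S.set 3 (r.eval P env S)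
      (residualLength (S 8 (env 0)) (S 9 (env 0)) (x.eval P env S)) := by
  simp only [setLength, Cmd.run, Ex.eval]
  unfold ifPos residualLength
  split_ifs <;> simp only [zero_sub]

/-- The residual network of the flow, where edges can be used up to flow `-lo`. -/
def setResidual (lo : ℤ) : Cmd :=
  .seq (.loop 1 true (setLength fwd (.arr 10 (.ctr 0))))
    (.seq (.loop 1 true (setLength bwd (.sub (.const 0) (.arr 10 (.ctr 0)))))
      (.seq (.loop 1 true (.set 2 fwd (.sub (.const 2) (.arr 10 (.ctr 0)))))
        (.loop 1 true (.set 2 bwd (.add (.arr 10 (.ctr 0)) (.const lo))))))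

/-- The network that consists of the arcs with positive flow. -/
def setSupport : Cmd :=
  .seq (.loop 1 true (.set 2 fwd (.arr 10 (.ctr 0))))
    (.loop 1 true (.set 2 bwd (.sub (.const 0) (.arr 10 (.ctr 0)))))

/-- Add `z` times the marked path to the flow. -/
def addPath (z : ℤ) : Cmd :=
  .loop 1 true (.set 10 (.ctr 0)
    (.add (.arr 10 (.ctr 0)) (.scale z (.sub (.arr 4 fwd) (.arr 4 bwd)))))

/-- Write the indicator vector of the marked path to the output, starting in position `o`. -/
def output (o : Ex) : Cmd :=
  .loop 1 true (.ite (.add (.arr 4 fwd) (.arr 4 bwd)) (.set 12 (.add o (.ctr 0)) (.const 1))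
    (.set 12 (.add o (.ctr 0)) (.const 0)))

section Loops

variable {P : ℤ → ℤ} {m : ℕ} {env : ℕ → ℤ} {S T : Arrays}

/-- The edge cost is an even function, so decreasing the flow from `z` costs the same as increasing
it from `-z`. This is why backward arcs get `residualLength` at the negated flow. -/
theorem run_setResidual (hm : P 2 = m) {lo : ℤ} (hT : (setResidual lo).run P 0 env S = T) :
    (∀ k, k ≠ 2 → k ≠ 3 → T k = S k) ∧ ∀ e : Fin m,
      T 2 (2 * (e : ℕ)) = 2 - S 10 (e : ℕ) ∧ T 2 (2 * (e : ℕ) + 1) = S 10 (e : ℕ) + lo ∧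
      T 3 (2 * (e : ℕ)) = residualLength (S 8 (e : ℕ)) (S 9 (e : ℕ)) (S 10 (e : ℕ)) ∧
      T 3 (2 * (e : ℕ) + 1) = residualLength (S 8 (e : ℕ)) (S 9 (e : ℕ)) (-S 10 (e : ℕ)) := by
  simp only [setResidual, Cmd.run.eq_3] at hT
  have hN : 1 * (P (cond true 2 1)).toNat = m := by simp [hm]
  obtain ⟨a1, a2, a3⟩ := run_loop_of_set (env := env) (d := 0) (S := S) hN 3 (fun i => 2 * (i : ℤ))
    (fun i => residualLength (S 8 i) (S 9 i) (S 10 i)) (fun i j h => by omega)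
    (p := setLength fwd (.arr 10 (.ctr 0))) (fun i _ T h1 h2 => by
      rw [run_setLength]
      simp only [Ex.eval, fwd, Function.update_self, h1 8 (by decide), h1 9 (by decide),
        h1 10 (by decide)]) rfl
  set S1 := (Cmd.loop 1 true (setLength fwd (.arr 10 (.ctr 0)))).run P 0 env S
  obtain ⟨b1, b2, b3⟩ := run_loop_of_set (env := env) (d := 0) (S := S1) hN 3
    (fun i => 2 * (i : ℤ) + 1)
    (fun i => residualLength (S 8 i) (S 9 i) (-S 10 i)) (fun i j h => by omega)
    (p := setLength bwd (.sub (.const 0) (.arr 10 (.ctr 0)))) (fun i _ T h1 h2 => by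
      rw [run_setLength]
      simp only [Ex.eval, bwd, Function.update_self, h1 8 (by decide), h1 9 (by decide),
        h1 10 (by decide), a1 8 (by decide), a1 9 (by decide), a1 10 (by decide), zero_sub]) rfl
  set S2 := (Cmd.loop 1 true (setLength bwd (.sub (.const 0) (.arr 10 (.ctr 0))))).run P 0 env S1
  obtain ⟨c1, c2, c3⟩ := run_loop_of_set (env := env) (d := 0) (S := S2) hN 2
    (fun i => 2 * (i : ℤ)) (fun i => 2 - S 10 i) (fun i j h => by omega)
    (p := .set 2 fwd (.sub (.const 2) (.arr 10 (.ctr 0)))) (fun i _ T h1 h2 => by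
      simp only [Cmd.run, Ex.eval, fwd, Function.update_self,
        h1 10 (by decide), b1 10 (by decide), a1 10 (by decide)]) rfl
  set S3 := (Cmd.loop 1 true (.set 2 fwd (.sub (.const 2) (.arr 10 (.ctr 0))))).run P 0 env S2
  obtain ⟨d1, d2, d3⟩ := run_loop_of_set (env := env) (d := 0) (S := S3) hN 2
    (fun i => 2 * (i : ℤ) + 1) (fun i => S 10 i + lo) (fun i j h => by omega)
    (p := .set 2 bwd (.add (.arr 10 (.ctr 0)) (.const lo))) (fun i _ T h1 h2 => by
      simp only [Cmd.run, Ex.eval, bwd, Function.update_self,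
        h1 10 (by decide), c1 10 (by decide), b1 10 (by decide), a1 10 (by decide)]) hT
  refine ⟨fun k h2 h3 => by rw [d1 k h2, c1 k h2, b1 k h3, a1 k h3], fun e => ⟨?_, d2 e e.isLt, ?_, ?_⟩⟩
  · rw [d3 _ fun i _ => by omega]
    exact c2 e e.isLt
  · rw [d1 3 (by decide), c1 3 (by decide), b3 _ fun i _ => by omega]
    exact a2 e e.isLt
  · rw [d1 3 (by decide), c1 3 (by decide)]
    exact b2 e e.isLt

theorem run_setSupport (hm : P 2 = m) (hT : setSupport.run P 0 env S = T) :
    (∀ k, k ≠ 2 → T k = S k) ∧ ∀ e : Fin m,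
      T 2 (2 * (e : ℕ)) = S 10 (e : ℕ) ∧ T 2 (2 * (e : ℕ) + 1) = -S 10 (e : ℕ) := by
  simp only [setSupport, Cmd.run.eq_3] at hT
  have hN : 1 * (P (cond true 2 1)).toNat = m := by simp [hm]
  obtain ⟨c1, c2, c3⟩ := run_loop_of_set (env := env) (d := 0) (S := S) hN 2
    (fun i => 2 * (i : ℤ)) (fun i => S 10 i) (fun i j h => by omega)
    (p := .set 2 fwd (.arr 10 (.ctr 0))) (fun i _ T h1 h2 => by
      simp only [Cmd.run, Ex.eval, fwd, Function.update_self, h1 10 (by decide)]) rfl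
  set S3 := (Cmd.loop 1 true (.set 2 fwd (.arr 10 (.ctr 0)))).run P 0 env S
  obtain ⟨d1, d2, d3⟩ := run_loop_of_set (env := env) (d := 0) (S := S3) hN 2
    (fun i => 2 * (i : ℤ) + 1) (fun i => -S 10 i) (fun i j h => by omega)
    (p := .set 2 bwd (.sub (.const 0) (.arr 10 (.ctr 0)))) (fun i _ T h1 h2 => by
      simp only [Cmd.run, Ex.eval, bwd, Function.update_self,
        h1 10 (by decide), c1 10 (by decide), zero_sub]) hT
  refine ⟨fun k h2 => by rw [d1 k h2, c1 k h2], fun e => ⟨?_, d2 e e.isLt⟩⟩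
  rw [d3 _ fun i _ => by omega]
  exact c2 e e.isLt

theorem run_addPath (hm : P 2 = m) {z : ℤ} (hT : (addPath z).run P 0 env S = T) :
    (∀ k, k ≠ 10 → T k = S k) ∧ ∀ e : Fin m,
      T 10 (e : ℕ) = S 10 (e : ℕ) + z * (S 4 (2 * (e : ℕ)) - S 4 (2 * (e : ℕ) + 1)) := by
  obtain ⟨c1, c2, c3⟩ := run_loop_of_set (env := env) (d := 0) (S := S)
    (show 1 * (P (cond true 2 1)).toNat = m by simp [hm]) 10
    (fun i => (i : ℤ)) (fun i => S 10 i + z * (S 4 (2 * i) - S 4 (2 * i + 1)))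
    (fun i j h => by omega) (fun i _ T h1 h2 => by
      simp only [Cmd.run, Ex.eval, fwd, bwd, Function.update_self, h1 4 (by decide), h2]) hT
  exact ⟨c1, fun e => c2 e e.isLt⟩

theorem run_output (hm : P 2 = m) {o : Ex} {z : ℤ} (ho : ∀ env S, o.eval P env S = z)
    (hT : (output o).run P 0 env S = T) :
    (∀ k, k ≠ 12 → T k = S k) ∧ (∀ e : Fin m,
      T 12 (z + (e : ℕ)) = if 0 < S 4 (2 * (e : ℕ)) + S 4 (2 * (e : ℕ) + 1) then 1 else 0) ∧
      ∀ j, j < z ∨ z + m ≤ j → T 12 j = S 12 j := by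
  obtain ⟨c1, c2, c3⟩ := run_loop_of_set (env := env) (d := 0) (S := S)
    (show 1 * (P (cond true 2 1)).toNat = m by simp [hm]) 12
    (fun i => z + (i : ℤ)) (fun i => if 0 < S 4 (2 * i) + S 4 (2 * i + 1) then 1 else 0)
    (fun i j h => by omega) (fun i _ T h1 h2 => by
      simp only [Cmd.run, Ex.eval, fwd, bwd, Function.update_self, h1 4 (by decide), ho]
      unfold ifPos
      split_ifs <;> rfl) hT
  exact ⟨c1, fun e => c2 e e.isLt, fun j hj => c3 j fun i hi => by omega⟩

end Loops

/-! ### The cost vectors -/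

/-- The position of the data of the edge given by the counter `d`, with offset `o`. -/
def edgeData (d : ℕ) (o : ℤ) : Ex :=
  .add (.add (.inp (.const 1)) (.scale 6 (.ctr d))) (.const (5 + o))

/-- Multiply the cost of the edge given by the counter `0` by the denominators of the edge given by
the counter `1`, except for its own denominator. -/
def scaleStep (k : Fin 14) (o o' : ℤ) : Cmd :=
  .seq (.set k (.ctr 0) (.mulInp (edgeData 1 o') (.arr k (.ctr 0))))
    (.ite (.sub (.ctr 0) (.ctr 1))
      (.set k (.ctr 0) (.mulInp (edgeData 1 o) (.arr k (.ctr 0))))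
      (.ite (.sub (.ctr 1) (.ctr 0))
        (.set k (.ctr 0) (.mulInp (edgeData 1 o) (.arr k (.ctr 0)))) .skip))

/-- Multiply the costs with offset `o` by the product of all denominators. -/
def scaleCosts (k : Fin 14) (o o' : ℤ) : Cmd :=
  .loop 1 true (.seq (.set k (.ctr 0) (.inp (edgeData 0 (o - 1)))) (.loop 1 true (scaleStep k o o')))

/-- The machine has no division, so the numerator is multiplied by all denominators but its own.
Denominators of both cost vectors enter, so that both vectors get the same scale; the result is
stated in multiplied-out form. -/
theorem run_scaleCosts {P : ℤ → ℤ} {m : ℕ} {env : ℕ → ℤ} {S T : Arrays} {k : Fin 14} {o o' : ℤ}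
    (hm : P 2 = m) (den : ℤ → ℕ → ℤ) (hden : ∀ o i, den o i = P (P 1 + 6 * i + (5 + o)))
    (hT : (scaleCosts k o o').run P 0 env S = T) :
    (∀ k', k' ≠ k → T k' = S k') ∧ ∀ e < m,
      T k e * den o e = den (o - 1) e * ∏ j ∈ range m, (den o j * den o' j) := by
  have hN : 1 * (P (cond true 2 1)).toNat = m := by simp [hm]
  have := Cmd.loop_invariant (P := P) (c := 1) (b := true) (d := 0) (env := env) (S := S)
    (p := .seq (.set k (.ctr 0) (.inp (edgeData 0 (o - 1)))) (.loop 1 true (scaleStep k o o')))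
    (fun n T => (∀ k', k' ≠ k → T k' = S k') ∧ ∀ e < n,
      T k e * den o e = den (o - 1) e * ∏ j ∈ range m, (den o j * den o' j)) hN
    ⟨fun _ _ => rfl, fun i hi => by omega⟩ ?_
  · rwa [scaleCosts, hT] at *
  rintro e he T ⟨h1, h2⟩
  rw [Cmd.run.eq_3]
  set env' := Function.update env 0 (e : ℤ)
  set T1 := (Cmd.set k (.ctr 0) (.inp (edgeData 0 (o - 1)))).run P (0 + 1) env' T with hT1
  have hT1' : T1 = T.set k e (den (o - 1) e) := by
    simp [hT1, Cmd.run, Ex.eval, edgeData, env', hden]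
  -- The own denominator is missing from the product once the inner loop has passed the index `e`;
  -- the conditional factor accounts for this.
  have := Cmd.loop_invariant (P := P) (c := 1) (b := true) (d := 1) (env := env') (S := T1)
    (p := scaleStep k o o')
    (fun n U => (∀ k', k' ≠ k → U k' = T k') ∧ (∀ j : ℤ, j ≠ e → U k j = T k j) ∧
      U k e * (if e < n then den o e else 1) =
        den (o - 1) e * ∏ j ∈ range n, (den o j * den o' j)) hN
    (by
      rw [hT1']
      refine ⟨fun k' hk => Arrays.set_of_ne _ hk _ _, fun j hj => ?_, ?_⟩
      · rw [Arrays.set_same, Function.update_of_ne hj]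
      · rw [Arrays.set_same, Function.update_self]
        simp) ?_
  · obtain ⟨f1, f2, f3⟩ := this
    refine ⟨fun k' hk => (f1 k' hk).trans (h1 k' hk), fun j hj => ?_⟩
    rcases eq_or_ne j e with rfl | hne
    · rw [if_pos he] at f3
      exact f3
    · rw [f2 j (by omega)]
      exact h2 j (by omega)
  · rintro i - U ⟨f1, f2, f3⟩
    have e0 : Function.update env' 1 (i : ℤ) 0 = e := by simp [env']
    simp only [scaleStep, Cmd.run, Ex.eval, edgeData, e0, Function.update_self, ← hden]
    rw [prod_range_succ]
    have key : ∀ U' : Arrays, (∃ x, U' = U.set k e x ∧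
        x = U k e * den o' i * if i = e then 1 else den o i) →
        (∀ k', k' ≠ k → U' k' = T k') ∧ (∀ j : ℤ, j ≠ e → U' k j = T k j) ∧
        U' k e * (if e < i + 1 then den o e else 1) =
        den (o - 1) e * ((∏ j ∈ range i, (den o j * den o' j)) * (den o i * den o' i)) := by
      rintro U' ⟨x, rfl, hx⟩
      refine ⟨fun k' hk => by rw [Arrays.set_of_ne _ hk, f1 k' hk], fun j hj => ?_, ?_⟩
      · rw [Arrays.set_same, Function.update_of_ne hj, f2 j hj]
      · rw [Arrays.set_same, Function.update_self, hx, ← mul_assoc (den (o - 1) e), ← f3]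
        rcases lt_trichotomy e i with h | rfl | h
        · rw [if_pos h, if_pos (show e < i + 1 by omega), if_neg (show i ≠ e by omega)]; ring
        · simp only [lt_irrefl, if_false, if_true, Nat.lt_succ_self]; ring
        · rw [if_neg (show ¬ e < i by omega), if_neg (show ¬ e < i + 1 by omega),
            if_neg (show i ≠ e by omega)]; ring
    apply key
    have hset : ∀ x y : ℤ, (U.set k e x).set k e y = U.set k e y := by
      intro x y
      funext k' j
      simp only [Arrays.set]
      split_ifs <;> rfl
    unfold ifPos
    simp only [Arrays.set_same, Function.update_self, hset]
    split_ifs with h1 h2 h3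
    all_goals first | omega | exact ⟨_, rfl, by ring⟩

/-! ### Reading the instance -/

theorem getD_flatMap {α : Type} {k : ℕ} {f : α → List ℤ} (hf : ∀ a, (f a).length = k) (l : List α)
    (i : ℕ) (hi : i < l.length) (o : ℕ) (ho : o < k) :
    (l.flatMap f).getD (k * i + o) 0 = (f l[i]).getD o 0 := by
  induction l generalizing i with
  | nil => simp at hi
  | cons a l ih =>
    rw [List.flatMap_cons]
    cases i with
    | zero => rw [List.getD_append _ _ _ _ (by rw [hf]; omega)]; simp
    | succ i =>
      rw [List.getD_append_right _ _ _ _ (by rw [hf, mul_add]; omega), hf,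
        show k * (i + 1) + o - k = k * i + o by rw [mul_add]; omega,
        ih i (by simpa using hi)]
      simp

theorem PathInstance.length_encode (I : PathInstance) :
    I.encode.length = 4 + I.n + 6 * I.m := by
  simp [PathInstance.encode, List.length_flatMap]
  ring

/-- Words start in cell `1`, and four header entries and `n` vertices precede the blocks of six;
hence the offset `n + 5`. -/
theorem PathInstance.inputStore_edge (I : PathInstance) (e : Fin I.m) (o : ℕ) (ho : o < 6) :
    inputStore I.encode (I.n + 6 * (e : ℕ) + (5 + o)) =
      [((I.ends e).1 : ℤ), ((I.ends e).2 : ℤ), (I.a e).num, ((I.a e).den : ℤ), (I.c e).num,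
        ((I.c e).den : ℤ)].getD o 0 := by
  unfold inputStore
  rw [if_neg (by omega), if_pos (by omega),
    show ((I.n + 6 * (e : ℕ) + (5 + o) : ℤ).toNat - 1) = 4 + I.n + (6 * e + o) by omega]
  unfold PathInstance.encode
  rw [List.getD_append_right _ _ _ _ (by simp; omega)]
  simp only [List.length_append, List.length_cons, List.length_nil, List.length_map,
    List.length_finRange]
  rw [show 4 + I.n + (6 * (e : ℕ) + o) - (0 + 1 + 1 + 1 + 1 + I.n) = 6 * e + o by omega]
  have := getD_flatMap (k := 6) (f := fun e : Fin I.m =>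
    [((I.ends e).1 : ℤ), ((I.ends e).2 : ℤ),
      (I.a e).num, ((I.a e).den : ℤ), (I.c e).num, ((I.c e).den : ℤ)]) (fun _ => rfl)
    (List.finRange I.m) e (by simp) o ho
  simpa using this

theorem PathInstance.inputStore_header (I : PathInstance) :
    inputStore I.encode 1 = I.n ∧ inputStore I.encode 2 = I.m ∧
      inputStore I.encode 3 = (I.s : ℕ) ∧ inputStore I.encode 4 = (I.t : ℕ) := by
  simp [inputStore, PathInstance.encode]

/-- Read the instance. -/
def readInstance : Cmd :=
  .seq (.loop 1 true (.set 0 fwd (.inp (edgeData 0 0))))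
    (.seq (.loop 1 true (.set 1 bwd (.inp (edgeData 0 0))))
      (.seq (.loop 1 true (.set 1 fwd (.inp (edgeData 0 1))))
        (.seq (.loop 1 true (.set 0 bwd (.inp (edgeData 0 1))))
          (.seq (.loop 1 true (.set 10 (.ctr 0) (.const 0)))
            (.seq (.loop 1 false (.set 7 (.ctr 0) (.const 0)))
              (.seq (scaleCosts 9 3 5) (scaleCosts 8 5 3)))))))

/-- The arrays hold the network with edge costs `C` and `A` and the flow `F`. -/
structure IsState {n m : ℕ} (ends : Fin m → Fin n × Fin n) (C A F : Fin m → ℤ) (S : Arrays) :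
    Prop where
  network : IsNetwork ends S
  cost : ∀ e : Fin m, S 8 (e : ℕ) = C e
  pairCost : ∀ e : Fin m, S 9 (e : ℕ) = A e
  flow : ∀ e : Fin m, S 10 (e : ℕ) = F e

theorem run_loop_const {P : ℤ → ℤ} {env : ℕ → ℤ} {S T : Arrays} {b : Bool} {N : ℕ}
    (hN : 1 * (P (cond b 2 1)).toNat = N) {k : Fin 14} {z : ℤ}
    (hT : (Cmd.loop 1 b (.set k (.ctr 0) (.const z))).run P 0 env S = T) :
    (∀ k', k' ≠ k → T k' = S k') ∧ ∀ i < N, T k (i : ℤ) = z := by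
  obtain ⟨h1, h2, -⟩ := run_loop_of_set hN k (fun i => (i : ℤ)) (fun _ => z)
    (fun i j h => by omega) (fun i _ T _ _ => by
      simp only [Cmd.run, Ex.eval, Function.update_self]) hT
  exact ⟨h1, h2⟩

theorem run_loop_edgeData {P : ℤ → ℤ} {env : ℕ → ℤ} {S T : Arrays} {m : ℕ} (hm : P 2 = m)
    {k : Fin 14} {r : Ex} {o z : ℤ} (hr : r = fwd ∧ z = 0 ∨ r = bwd ∧ z = 1)
    (hT : (Cmd.loop 1 true (.set k r (.inp (edgeData 0 o)))).run P 0 env S = T) :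
    (∀ k', k' ≠ k → T k' = S k') ∧ (∀ i < m, T k (2 * (i : ℤ) + z) = P (P 1 + 6 * i + (5 + o))) ∧
      ∀ i < m, T k (2 * (i : ℤ) + (1 - z)) = S k (2 * (i : ℤ) + (1 - z)) := by
  obtain ⟨h1, h2, h3⟩ := run_loop_of_set (show 1 * (P (cond true 2 1)).toNat = m by simp [hm]) k
    (fun i => 2 * (i : ℤ) + z) (fun i => P (P 1 + 6 * i + (5 + o)))
    (fun i j h => by omega) (fun i _ T _ _ => by
      rcases hr with ⟨rfl, rfl⟩ | ⟨rfl, rfl⟩ <;>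
      simp only [fwd, bwd, edgeData, Cmd.run, Ex.eval, Function.update_self, add_zero]) hT
  exact ⟨h1, h2, fun i _ => h3 _ fun j _ => by omega⟩

theorem exists_scaled {m : ℕ} {a : Fin m → ℚ} {p q x : ℕ → ℤ} {D : ℤ}
    (hp : ∀ e : Fin m, p e = (a e).num) (hq : ∀ e : Fin m, q e = (a e).den)
    (h : ∀ e < m, x e * q e = p e * D) (e : Fin m) : (x e : ℚ) = a e * D := by
  have h1 := h e e.isLt
  rw [hp, hq] at h1
  have h2 : (x e : ℚ) * (a e).den = (a e).num * D := by exact_mod_cast h1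
  have h3 : ((a e).den : ℚ) ≠ 0 := by exact_mod_cast (a e).den_ne_zero
  have h4 := Rat.num_div_den (a e)
  field_simp at h4
  have h5 : (x e : ℚ) * (a e).den = a e * D * (a e).den := by
    rw [h2]
    nth_rewrite 1 [h4]
    ring
  exact mul_right_cancel₀ h3 h5

theorem run_readInstance (I : PathInstance) {P : ℤ → ℤ} {env : ℕ → ℤ} {S T : Arrays}
    (hP : ∀ i, 0 ≤ i → P i = inputStore I.encode i) (hT : readInstance.run P 0 env S = T) :
    ∃ (C A : Fin I.m → ℤ) (D : ℚ), 0 < D ∧ (∀ e, (C e : ℚ) = I.c e * D) ∧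
      (∀ e, (A e : ℚ) = I.a e * D) ∧ IsState I.ends C A (fun _ => 0) T ∧
      ∀ v : Fin I.n, T 7 (v : ℕ) = 0 := by
  have h1 : P 1 = I.n := (hP 1 (by omega)).trans I.inputStore_header.1
  have h2 : P 2 = I.m := (hP 2 (by omega)).trans I.inputStore_header.2.1
  have hE : ∀ (o : ℕ) (e : Fin I.m), o < 6 → P (P 1 + 6 * (e : ℕ) + (5 + o)) =
      [((I.ends e).1 : ℤ), ((I.ends e).2 : ℤ), (I.a e).num, ((I.a e).den : ℤ), (I.c e).num,
        ((I.c e).den : ℤ)].getD o 0 := by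
    intro o e ho
    rw [h1, hP _ (by omega), I.inputStore_edge e o ho]
  have hN : 1 * (P (cond true 2 1)).toNat = I.m := by simp [h2]
  simp only [readInstance, Cmd.run.eq_3] at hT
  obtain ⟨a1, a2, a3⟩ := run_loop_edgeData (env := env) (S := S) h2 (k := 0) (o := 0)
    (.inl ⟨rfl, rfl⟩) rfl
  generalize (Cmd.loop 1 true (.set 0 fwd (.inp (edgeData 0 0)))).run P 0 env S = S1 at *
  obtain ⟨b1, b2, b3⟩ := run_loop_edgeData (env := env) (S := S1) h2 (k := 1) (o := 0)
    (.inr ⟨rfl, rfl⟩) rfl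
  generalize (Cmd.loop 1 true (.set 1 bwd (.inp (edgeData 0 0)))).run P 0 env S1 = S2 at *
  obtain ⟨c1, c2, c3⟩ := run_loop_edgeData (env := env) (S := S2) h2 (k := 1) (o := 1)
    (.inl ⟨rfl, rfl⟩) rfl
  generalize (Cmd.loop 1 true (.set 1 fwd (.inp (edgeData 0 1)))).run P 0 env S2 = S3 at *
  obtain ⟨d1, d2, d3⟩ := run_loop_edgeData (env := env) (S := S3) h2 (k := 0) (o := 1)
    (.inr ⟨rfl, rfl⟩) rfl
  generalize (Cmd.loop 1 true (.set 0 bwd (.inp (edgeData 0 1)))).run P 0 env S3 = S4 at *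
  obtain ⟨e1, e2⟩ := run_loop_const (env := env) (S := S4) hN (k := 10) (z := 0) rfl
  generalize (Cmd.loop 1 true (.set 10 (.ctr 0) (.const 0))).run P 0 env S4 = S5 at *
  obtain ⟨f1, f2⟩ := run_loop_const (env := env) (S := S5) (b := false)
    (show 1 * (P (cond false 2 1)).toNat = I.n by simp [h1]) (k := 7) (z := 0) rfl
  generalize (Cmd.loop 1 false (.set 7 (.ctr 0) (.const 0))).run P 0 env S5 = S6 at *
  obtain ⟨g1, g2⟩ := run_scaleCosts (env := env) (S := S6) (k := 9) (o := 3) (o' := 5) h2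
    (fun o i => P (P 1 + 6 * i + (5 + o))) (fun _ _ => rfl) rfl
  generalize (scaleCosts 9 3 5).run P 0 env S6 = S7 at *
  obtain ⟨i1, i2⟩ := run_scaleCosts (env := env) (S := S7) (k := 8) (o := 5) (o' := 3) h2
    (fun o i => P (P 1 + 6 * i + (5 + o))) (fun _ _ => rfl) hT
  -- The two scalings multiply the same pairs of denominators in opposite order; this identifies the
  -- common factor.
  have hcomm : ∏ j ∈ range I.m, (P (P 1 + 6 * j + (5 + 5)) * P (P 1 + 6 * j + (5 + 3))) =
      ∏ j ∈ range I.m, (P (P 1 + 6 * j + (5 + 3)) * P (P 1 + 6 * j + (5 + 5))) :=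
    prod_congr rfl fun _ _ => mul_comm _ _
  rw [hcomm] at i2
  have hpos : 0 < ∏ j ∈ range I.m, (P (P 1 + 6 * j + (5 + 3)) * P (P 1 + 6 * j + (5 + 5))) := by
    refine prod_pos fun j hj => ?_
    have e3 := hE 3 ⟨j, mem_range.1 hj⟩ (by omega)
    have e5 := hE 5 ⟨j, mem_range.1 hj⟩ (by omega)
    simp only [Nat.cast_ofNat, List.getD_cons_succ, List.getD_cons_zero] at e3 e5
    rw [e3, e5]
    have := (I.a ⟨j, mem_range.1 hj⟩).den_pos
    have := (I.c ⟨j, mem_range.1 hj⟩).den_pos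
    positivity
  set D := ∏ j ∈ range I.m, (P (P 1 + 6 * j + (5 + 3)) * P (P 1 + 6 * j + (5 + 5)))
  refine ⟨fun e => T 8 (e : ℕ), fun e => T 9 (e : ℕ), D, by exact_mod_cast hpos,
    exists_scaled (x := fun e => T 8 (e : ℕ)) (p := fun e => P (P 1 + 6 * e + (5 + 4)))
      (q := fun e => P (P 1 + 6 * e + (5 + 5))) (fun e => hE 4 e (by omega))
      (fun e => hE 5 e (by omega)) i2,
    exists_scaled (x := fun e => T 9 (e : ℕ)) (p := fun e => P (P 1 + 6 * e + (5 + 2)))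
      (q := fun e => P (P 1 + 6 * e + (5 + 3))) (fun e => hE 2 e (by omega))
      (fun e => hE 3 e (by omega)) (fun e he => by rw [i1 9 (by decide)]; exact g2 e he),
    ⟨fun e => ?_, fun _ => rfl, fun _ => rfl, fun e => ?_⟩, fun v => ?_⟩
  · have he := e.isLt
    have z1 := a2 e he
    have z2 := b2 e he
    have z3 := c2 e he
    have z4 := d2 e he
    have z5 := c3 e he
    have z6 := d3 e he
    have E0 := hE 0 e (by omega)
    have E1 := hE 1 e (by omega)
    simp only [Nat.cast_zero, Nat.cast_one, List.getD_cons_succ, List.getD_cons_zero,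
      add_zero] at E0 E1
    simp only [sub_zero, sub_self, add_zero, E0, E1] at z1 z2 z3 z4 z5 z6
    simp only [i1 0 (by decide), i1 1 (by decide), g1 0 (by decide), g1 1 (by decide),
      f1 0 (by decide), f1 1 (by decide), e1 0 (by decide), e1 1 (by decide), d1 1 (by decide)]
    refine ⟨?_, z3, z4, ?_⟩
    · rw [z6, c1 0 (by decide), b1 0 (by decide), z1]
    · rw [z5, z2]
  · rw [i1 10 (by decide), g1 10 (by decide), f1 10 (by decide)]
    exact e2 e e.isLt
  · rw [i1 7 (by decide), g1 7 (by decide)]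
    exact f2 v v.isLt

/-! ### Augmenting the flow -/

/-- Search the residual network. -/
def stage (lo : ℤ) : Cmd := .seq (setResidual lo) search

/-- The flow is optimal for the current potentials. -/
def IsOptimal {n m : ℕ} (ends : Fin m → Fin n × Fin n) (lo : ℤ) (C A F : Fin m → ℤ) (S : Arrays) :
    Prop :=
  ∀ e, IsTight lo (C e) (A e) (S 7 ((ends e).2 : ℕ) - S 7 ((ends e).1 : ℕ)) (F e)

/-- The residual network of the flow has been searched. -/
structure IsSearched {n m : ℕ} (ends : Fin m → Fin n × Fin n) (lo : ℤ) (C A F : Fin m → ℤ)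
    (s : Fin n) (S : Arrays) : Prop where
  state : IsState ends C A F S
  optimal : IsOptimal ends lo C A F S
  tree : IsTree n m (s : ℕ) True n S
  closed : Closed m S
  usable_fwd : ∀ e : Fin m, S 2 (2 * (e : ℕ)) = 2 - F e
  usable_bwd : ∀ e : Fin m, S 2 (2 * (e : ℕ) + 1) = F e + lo
  slack_fwd : ∀ e : Fin m, slack S (2 * (e : ℕ)) =
    residualLength (C e) (A e) (F e) - (S 7 ((ends e).2 : ℕ) - S 7 ((ends e).1 : ℕ))
  slack_bwd : ∀ e : Fin m, slack S (2 * (e : ℕ) + 1) =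
    residualLength (C e) (A e) (-F e) + (S 7 ((ends e).2 : ℕ) - S 7 ((ends e).1 : ℕ))

section Round

variable {n m : ℕ} {ends : Fin m → Fin n × Fin n} {lo : ℤ} {C A F : Fin m → ℤ} {s t : Fin n}
  {P : ℤ → ℤ} {env : ℕ → ℤ} {S T : Arrays}

theorem IsState.congr (h : IsState ends C A F S) (h0 : T 0 = S 0) (h1 : T 1 = S 1)
    (h8 : T 8 = S 8) (h9 : T 9 = S 9) (h10 : T 10 = S 10) : IsState ends C A F T := by
  obtain ⟨a, b, c, d⟩ := h
  refine ⟨?_, by rwa [h8], by rwa [h9], by rwa [h10]⟩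
  unfold IsNetwork
  rwa [h0, h1]

/-- Tightness of the flow is the same as nonnegativity of the reduced lengths of the residual arcs.
The search preserves the latter, so the flow is also tight for the new potentials. -/
theorem run_stage (hn : P 1 = n) (hm : P 2 = m) (hs : P 3 = (s : ℕ)) (hS : IsState ends C A F S)
    (hopt : IsOptimal ends lo C A F S) (hT : (stage lo).run P 0 env S = T) :
    IsSearched ends lo C A F s T := by
  rw [stage, Cmd.run.eq_3] at hT
  obtain ⟨a1, a2⟩ := run_setResidual (env := env) (S := S) (lo := lo) hm rfl
  generalize (setResidual lo).run P 0 env S = S1 at *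
  simp only [hS.cost, hS.pairCost, hS.flow] at a2
  have h1 : IsState ends C A F S1 := hS.congr (a1 0 (by decide) (by decide))
    (a1 1 (by decide) (by decide)) (a1 8 (by decide) (by decide)) (a1 9 (by decide) (by decide))
    (a1 10 (by decide) (by decide))
  -- Stated for arbitrary arrays because it is needed with the potentials before and after the
  -- search.
  have hsl : ∀ U : Arrays, U 3 = S1 3 → IsState ends C A F U → (∀ e : Fin m,
      slack U (2 * (e : ℕ)) = residualLength (C e) (A e) (F e) -
        (U 7 ((ends e).2 : ℕ) - U 7 ((ends e).1 : ℕ))) ∧ ∀ e : Fin m,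
      slack U (2 * (e : ℕ) + 1) = residualLength (C e) (A e) (-F e) +
        (U 7 ((ends e).2 : ℕ) - U 7 ((ends e).1 : ℕ)) := by
    refine fun U h3 hU => ⟨fun e => ?_, fun e => ?_⟩ <;>
      obtain ⟨n1, n2, n3, n4⟩ := hU.network e <;> obtain ⟨-, -, c3, c4⟩ := a2 e <;>
      unfold slack
    · rw [n1, n2, h3, c3]; ring
    · rw [n3, n4, h3, c4]; ring
  have hfeas : Feasible m S1 := by
    intro r hr hr' hact
    obtain ⟨f1, f2⟩ := hsl S1 rfl h1
    obtain ⟨e, rfl | rfl⟩ := exists_edge_of_arc hr hr'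
    · rw [f1 e, a1 7 (by decide) (by decide)]
      rw [(a2 e).1] at hact
      exact (hopt e).1 (by omega)
    · rw [f2 e, a1 7 (by decide) (by decide)]
      rw [(a2 e).2.1] at hact
      exact (hopt e).2 hact
  obtain ⟨b1, b2, b3⟩ := run_search hn hm (by omega) (by omega) h1.network.validArcs
    (Q := True) (fun _ => hfeas) hT
  have hT' : IsState ends C A F T := h1.congr
    (b1 0 (by decide) (by decide) (by decide) (by decide))
    (b1 1 (by decide) (by decide) (by decide) (by decide))
    (b1 8 (by decide) (by decide) (by decide) (by decide))
    (b1 9 (by decide) (by decide) (by decide) (by decide))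
    (b1 10 (by decide) (by decide) (by decide) (by decide))
  obtain ⟨f1, f2⟩ := hsl T (b1 3 (by decide) (by decide) (by decide) (by decide)) hT'
  have hT2 : T 2 = S1 2 := b1 2 (by decide) (by decide) (by decide) (by decide)
  have hfeas' := b2.feasible trivial
  rw [hs] at b2
  refine ⟨hT', fun e => ⟨fun h => ?_, fun h => ?_⟩, b2, b3, fun e => ?_, fun e => ?_, f1, f2⟩
  · rw [← f1 e]
    refine hfeas' _ (by omega) (by omega) ?_
    rw [hT2, (a2 e).1]
    omega
  · rw [← f2 e]
    refine hfeas' _ (by omega) (by omega) ?_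
    rw [hT2, (a2 e).2.1]
    omega
  · rw [hT2, (a2 e).1]
  · rw [hT2, (a2 e).2.1]

/-- If the second terminal is not reached, then there are no paths. -/
theorem IsSearched.paths_eq_empty {und : Bool} (h : IsSearched ends (cond und 2 0) C A F s S)
    (hF : ∀ e, -1 ≤ F e ∧ F e ≤ 1) (ht : ¬ 0 < S 5 (t : ℕ)) :
    paths (Traverses ends und) s t = ∅ := by
  rw [Set.eq_empty_iff_forall_notMem]
  rintro _ ⟨p, hp, -, -⟩
  refine ht (hp.mem_of_closed (R := {v : Fin n | 0 < S 5 (v : ℕ)}) (fun e u v huv hu => ?_)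
    (show 0 < S 5 (s : ℕ) by rw [h.tree.root]; omega))
  obtain ⟨n1, n2, n3, n4⟩ := h.state.network e
  -- With at most one unit on each edge, the residual capacities `2 - F e` and, for undirected
  -- graphs, `F e + 2` are positive: every permitted traversal is usable.
  have := hF e
  by_contra hv
  rcases huv with huv | ⟨rfl, huv⟩ <;> rw [huv] at n1 n2 n3 n4
  · refine h.closed (2 * (e : ℕ)) (by omega) (by omega) ⟨?_, ?_, ?_⟩
    · rw [h.usable_fwd]; omega
    · rw [n1]; exact hu
    · rw [n2]; exact hv
  · refine h.closed (2 * (e : ℕ) + 1) (by omega) (by omega) ⟨?_, ?_, ?_⟩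
    · rw [h.usable_bwd, cond_true]; omega
    · rw [n3]; exact hu
    · rw [n4]; exact hv

/-- Send one unit of flow through the path that has been found. -/
def augment : Cmd := .seq trace (addPath 1)

/-- The path consists of residual arcs of reduced length zero, so `IsTight.augment` applies edge by
edge. The unit bound on the change gives `|F'| ≤ 1` after the first augmentation, which the
infeasibility test needs. -/
theorem run_augment (hn : P 1 = n) (hm : P 2 = m) (ht : P 4 = (t : ℕ)) {k : ℤ}
    (hC : ∀ e, 0 ≤ C e) (hA : ∀ e, 0 ≤ A e) (hlo : lo = 0 ∨ lo = 2)
    (hS : IsSearched ends lo C A F s S) (hF : IsFlow ends s t F k)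
    (hF' : ∀ e, -lo ≤ F e ∧ F e ≤ 2) (hreach : 0 < S 5 (t : ℕ))
    (hT : augment.run P 0 env S = T) :
    ∃ F' : Fin m → ℤ, IsState ends C A F' T ∧ IsOptimal ends lo C A F' T ∧
      IsFlow ends s t F' (k + 1) ∧ ∀ e, (-lo ≤ F' e ∧ F' e ≤ 2) ∧ F e - 1 ≤ F' e ∧ F' e ≤ F e + 1 := by
  rw [augment, Cmd.run.eq_3] at hT
  obtain ⟨a1, p, a2⟩ := run_trace (env := env) hn hm ht hS.state.network hS.tree hreach rfl
  generalize trace.run P 0 env S = S1 at *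
  obtain ⟨b1, b2⟩ := run_addPath hm hT
  simp only [a1 10 (by decide) (by decide), hS.state.flow, one_mul] at b2
  have hT' : ∀ k, k ≠ 4 → k ≠ 11 → k ≠ 10 → T k = S k := fun k h1 h2 h3 => by
    rw [b1 k h3, a1 k h1 h2]
  have hp : ∀ e : Fin m, S1 4 (2 * (e : ℕ)) = 0 ∨ S1 4 (2 * (e : ℕ)) = 1 ∧ F e < 2 ∧
      residualLength (C e) (A e) (F e) - (S 7 ((ends e).2 : ℕ) - S 7 ((ends e).1 : ℕ)) = 0 := by
    intro e
    refine (a2.mark (2 * (e : ℕ)) (by omega) (by omega)).imp_right fun ⟨h1, h2, h3⟩ => ?_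
    have h3 := h3 trivial
    rw [hS.slack_fwd] at h3
    rw [hS.usable_fwd] at h2
    exact ⟨h1, by omega, h3⟩
  have hq : ∀ e : Fin m, S1 4 (2 * (e : ℕ) + 1) = 0 ∨ S1 4 (2 * (e : ℕ) + 1) = 1 ∧ 0 < F e + lo ∧
      residualLength (C e) (A e) (-F e) + (S 7 ((ends e).2 : ℕ) - S 7 ((ends e).1 : ℕ)) = 0 := by
    intro e
    refine (a2.mark (2 * (e : ℕ) + 1) (by omega) (by omega)).imp_right fun ⟨h1, h2, h3⟩ => ?_
    have h3 := h3 trivial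
    rw [hS.slack_bwd] at h3
    rw [hS.usable_bwd] at h2
    exact ⟨h1, h2, h3⟩
  have haug := fun e => (hS.optimal e).augment (hC e) (hA e) hlo (hF' e).1 (hF' e).2 (hp e) (hq e)
  refine ⟨fun e => F e + (S1 4 (2 * (e : ℕ)) - S1 4 (2 * (e : ℕ) + 1)), ⟨?_, ?_, ?_, b2⟩,
    fun e => ?_, hF.add a2.isFlow, fun e => ⟨?_, ?_⟩⟩
  · unfold IsNetwork
    rw [hT' 0 (by decide) (by decide) (by decide), hT' 1 (by decide) (by decide) (by decide)]
    exact hS.state.network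
  · rw [hT' 8 (by decide) (by decide) (by decide)]
    exact hS.state.cost
  · rw [hT' 9 (by decide) (by decide) (by decide)]
    exact hS.state.pairCost
  · rw [hT' 7 (by decide) (by decide) (by decide)]
    simpa only [add_sub_assoc] using (haug e).1
  · simpa only [add_sub_assoc] using (haug e).2
  · have := hp e
    have := hq e
    beta_reduce
    omega

/-! ### Decomposing the flow -/

/-- Find a path in the support of the flow. -/
def extract : Cmd := .seq setSupport (.seq search trace)

/-- The path follows the direction of the flow on each of its edges, so subtracting it lowers `|F
e|` by exactly one there and never reverses a sign. -/
theorem run_extract (hn : P 1 = n) (hm : P 2 = m) (hs : P 3 = (s : ℕ)) (ht : P 4 = (t : ℕ))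
    {und : Bool} {k : ℤ} (hS : IsState ends C A F S) (hF : IsFlow ends s t F k) (hk : 0 < k)
    (hF' : und = false → ∀ e, 0 ≤ F e) (hT : extract.run P 0 env S = T) :
    IsState ends C A F T ∧ T 12 = S 12 ∧ ∃ E ∈ paths (Traverses ends und) s t,
      IsFlow ends s t (fun e : Fin m => T 4 (2 * (e : ℕ)) - T 4 (2 * (e : ℕ) + 1)) 1 ∧
      ∀ e : Fin m, (T 4 (2 * (e : ℕ)) + T 4 (2 * (e : ℕ) + 1) = if e ∈ E then 1 else 0) ∧
        |F e - (T 4 (2 * (e : ℕ)) - T 4 (2 * (e : ℕ) + 1))| + (if e ∈ E then 1 else 0) = |F e| ∧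
        (und = false → 0 ≤ F e - (T 4 (2 * (e : ℕ)) - T 4 (2 * (e : ℕ) + 1))) := by
  simp only [extract, Cmd.run.eq_3] at hT
  obtain ⟨a1, a2⟩ := run_setSupport (env := env) (S := S) hm rfl
  generalize setSupport.run P 0 env S = S1 at *
  simp only [hS.flow] at a2
  have h1 : IsState ends C A F S1 := hS.congr (a1 0 (by decide)) (a1 1 (by decide))
    (a1 8 (by decide)) (a1 9 (by decide)) (a1 10 (by decide))
  -- Only reachability matters here; with `Q := False` nothing is claimed about lengths.
  obtain ⟨b1, b2, b3⟩ := run_search (env := env) hn hm (by omega) (by omega) h1.network.validArcs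
    (Q := False) False.elim rfl
  rw [hs] at b2
  generalize search.run P 0 env S1 = S2 at *
  have h2 : IsState ends C A F S2 := h1.congr
    (b1 0 (by decide) (by decide) (by decide) (by decide))
    (b1 1 (by decide) (by decide) (by decide) (by decide))
    (b1 8 (by decide) (by decide) (by decide) (by decide))
    (b1 9 (by decide) (by decide) (by decide) (by decide))
    (b1 10 (by decide) (by decide) (by decide) (by decide))
  rw [← b1 2 (by decide) (by decide) (by decide) (by decide)] at a2
  -- A positive flow cannot stay inside a set without `t` that no support arc leaves.
  have hreach : 0 < S2 5 (t : ℕ) := by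
    refine hF.mem_of_closed hk (R := {v : Fin n | 0 < S2 5 (v : ℕ)})
      (show 0 < S2 5 (s : ℕ) by rw [b2.root]; omega) (fun e he hu => ?_) (fun e he hu => ?_) <;>
      obtain ⟨n1, n2, n3, n4⟩ := h2.network e <;> by_contra hv
    · refine b3 (2 * (e : ℕ)) (by omega) (by omega) ⟨?_, ?_, ?_⟩
      · rw [(a2 e).1]; exact he
      · rw [n1]; exact hu
      · rw [n2]; exact hv
    · refine b3 (2 * (e : ℕ) + 1) (by omega) (by omega) ⟨?_, ?_, ?_⟩
      · rw [(a2 e).2]; omega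
      · rw [n3]; exact hu
      · rw [n4]; exact hv
  obtain ⟨c1, p, c2⟩ := run_trace hn hm ht h2.network b2 hreach hT
  refine ⟨h2.congr (c1 0 (by decide) (by decide)) (c1 1 (by decide) (by decide))
    (c1 8 (by decide) (by decide)) (c1 9 (by decide) (by decide)) (c1 10 (by decide) (by decide)),
    ?_, (p.map Prod.fst).toFinset, ⟨p, c2.isWalk.mono fun e u v h => ?_, c2.nodup, rfl⟩,
    c2.isFlow, fun e => ?_⟩
  · rw [c1 12 (by decide) (by decide), b1 12 (by decide) (by decide) (by decide) (by decide),
      a1 12 (by decide)]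
  · rcases h with ⟨-, h⟩ | ⟨h', h⟩
    · exact .inl h
    · refine .inr ⟨?_, h⟩
      by_contra hund
      have := hF' (by simpa using hund) e
      rw [(a2 e).2] at h'
      omega
  · have hp := c2.mark (2 * (e : ℕ)) (by omega) (by omega)
    have hq := c2.mark (2 * (e : ℕ) + 1) (by omega) (by omega)
    rw [(a2 e).1] at hp
    rw [(a2 e).2] at hq
    have hmem : e ∈ (p.map Prod.fst).toFinset ↔ T 4 (2 * (e : ℕ)) = 1 ∨ T 4 (2 * (e : ℕ) + 1) = 1 := by
      rw [List.mem_toFinset, c2.mem_iff]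
    have := fun h => hF' h e
    rcases hp with hp | ⟨hp, hp', -⟩ <;> rcases hq with hq | ⟨hq, hq', -⟩ <;>
      rw [hp, hq] at hmem ⊢
    · rw [if_neg (by rw [hmem]; simp)]
      exact ⟨by simp, by simp, by simpa using this⟩
    · rw [if_pos (by rw [hmem]; simp)]
      refine ⟨by simp, ?_, fun h => ?_⟩
      · rw [abs_of_neg (show F e < 0 by omega), abs_of_nonpos (by omega)]
        ring
      · have := this h
        omega
    · rw [if_pos (by rw [hmem]; simp)]
      refine ⟨by simp, ?_, fun h => ?_⟩
      · rw [abs_of_pos hp', abs_of_nonneg (by omega)]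
        ring
      · omega
    · omega

/-- Decompose a flow of value two and write the two paths to the output. -/
def decompose : Cmd :=
  .seq extract (.seq (output (.const 2)) (.seq (addPath (-1)) (.seq extract
    (.seq (output (.add (.const 2) (.inp (.const 2))))
      (.seq (.set 12 (.const 0) (.add (.const 1) (.scale 2 (.inp (.const 2)))))
        (.set 12 (.const 1) (.const 1)))))))

/-- Removing one path leaves a flow of value one, which contains a second path. Since each removal
lowers absolute values exactly, the two paths together use an edge at most `|F e|` times. -/
theorem run_decompose (hn : P 1 = n) (hm : P 2 = m) (hs : P 3 = (s : ℕ)) (ht : P 4 = (t : ℕ))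
    {und : Bool} (hS : IsState ends C A F S) (hF : IsFlow ends s t F 2)
    (hF' : und = false → ∀ e, 0 ≤ F e) (hT : decompose.run P 0 env S = T) :
    ∃ E₁ ∈ paths (Traverses ends und) s t, ∃ E₂ ∈ paths (Traverses ends und) s t,
      (∀ e, (if e ∈ E₁ then 1 else 0) + (if e ∈ E₂ then 1 else 0) ≤ |F e|) ∧
      T 12 0 = 1 + 2 * m ∧ T 12 1 = 1 ∧ (∀ e : Fin m, T 12 (2 + (e : ℕ)) = if e ∈ E₁ then 1 else 0) ∧
      ∀ e : Fin m, T 12 (2 + m + (e : ℕ)) = if e ∈ E₂ then 1 else 0 := by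
  simp only [decompose, Cmd.run.eq_3] at hT
  obtain ⟨a1, -, E₁, hE₁, a2, a3⟩ := run_extract (env := env) hn hm hs ht hS hF (by norm_num) hF' rfl
  generalize extract.run P 0 env S = S1 at *
  obtain ⟨b1, b2, b3⟩ := run_output (env := env) (S := S1) (o := .const 2) (z := 2) hm
    (fun _ _ => rfl) rfl
  generalize (output (.const 2)).run P 0 env S1 = S2 at *
  obtain ⟨c1, c2⟩ := run_addPath (env := env) (S := S2) (z := -1) hm rfl
  generalize (addPath (-1)).run P 0 env S2 = S3 at *
  have h3 : IsState ends C A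
      (fun e : Fin m => F e - (S1 4 (2 * (e : ℕ)) - S1 4 (2 * (e : ℕ) + 1))) S3 := by
    have h2 := a1.congr (b1 0 (by decide)) (b1 1 (by decide)) (b1 8 (by decide)) (b1 9 (by decide))
      (b1 10 (by decide))
    refine ⟨?_, by rw [c1 8 (by decide)]; exact h2.cost, by rw [c1 9 (by decide)]; exact h2.pairCost,
      fun e => ?_⟩
    · unfold IsNetwork
      rw [c1 0 (by decide), c1 1 (by decide)]
      exact h2.network
    · rw [c2, h2.flow, b1 4 (by decide)]
      ring
  obtain ⟨d1, d2, E₂, hE₂, d3, d4⟩ := run_extract (env := env) hn hm hs ht h3 (hF.sub a2)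
    (by norm_num) (fun h e => (a3 e).2.2 h) rfl
  generalize extract.run P 0 env S3 = S4 at *
  obtain ⟨e1, e2, e3⟩ := run_output (env := env) (S := S4) (o := .add (.const 2) (.inp (.const 2)))
    (z := 2 + m) hm (fun _ _ => by simp only [Ex.eval, hm]) rfl
  generalize (output (.add (.const 2) (.inp (.const 2)))).run P 0 env S4 = S5 at *
  simp only [Cmd.run, Ex.eval] at hT
  have hT12 : T 12 = Function.update (Function.update (S5 12) 0 (1 + 2 * P 2)) 1 1 := by
    rw [← hT, Arrays.set_same, Arrays.set_same]
  have hind : ∀ p : Prop, ∀ [Decidable p] (x : ℤ), (x = if p then 1 else 0) →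
      (if 0 < x then (1 : ℤ) else 0) = if p then 1 else 0 := by
    rintro p _ x rfl
    split_ifs <;> simp_all
  refine ⟨E₁, hE₁, E₂, hE₂, fun e => ?_, ?_, ?_, fun e => ?_, fun e => ?_⟩
  · have h1 := (a3 e).2.1
    have h2 := (d4 e).2.1
    -- The remaining circulation is discarded; only the nonnegativity of its absolute value is used.
    have := abs_nonneg (F e - (S1 4 (2 * (e : ℕ)) - S1 4 (2 * (e : ℕ) + 1)) -
      (S4 4 (2 * (e : ℕ)) - S4 4 (2 * (e : ℕ) + 1)))
    linarith
  · rw [hT12, Function.update_of_ne (by decide), Function.update_self, hm]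
  · rw [hT12, Function.update_self]
  · have := e.isLt
    rw [hT12, Function.update_of_ne (by omega), Function.update_of_ne (by omega),
      e3 _ (by omega), d2, c1 12 (by decide), b2 e]
    exact hind _ _ (a3 e).1
  · rw [hT12, Function.update_of_ne (by omega), Function.update_of_ne (by omega), e2 e]
    exact hind _ _ (d4 e).1

end Round

/-! ### The algorithm -/

/-- Report that there are no paths. -/
def reportNone : Cmd := .seq (.set 12 (.const 0) (.const 1)) (.set 12 (.const 1) (.const 0))

/-- The algorithm: compute an optimal flow of value two by two augmentations, and decompose it. -/
def solve (lo : ℤ) : Cmd :=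
  .seq readInstance (.seq (stage lo) (.ite (.arr 5 (.inp (.const 4)))
    (.seq augment (.seq (stage lo) (.ite (.arr 5 (.inp (.const 4)))
      (.seq augment decompose) reportNone)))
    reportNone))

theorem length_indicatorWord {m : ℕ} (S : Finset (Fin m)) : (indicatorWord S).length = m := by
  simp [indicatorWord]

theorem run_solve (I : PathInstance) (ha : 0 ≤ I.a) (hc : 0 ≤ I.c) (und : Bool) {P : ℤ → ℤ}
    {env : ℕ → ℤ} {S T : Arrays} (hP : ∀ i, 0 ≤ i → P i = inputStore I.encode i)
    (hT : (solve (cond und 2 0)).run P 0 env S = T) :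
    ∃ y, IsAnswer (paths (Traverses I.ends und) I.s I.t) (paths (Traverses I.ends und) I.s I.t)
        (Matrix.diagonal I.a) I.c I.c y ∧ (encodeAnswer y).length ≤ I.encode.length ∧
      T 12 0 = (encodeAnswer y).length ∧ ∀ i : Fin (encodeAnswer y).length,
        T 12 ((i : ℕ) + 1 : ℤ) = (encodeAnswer y).get i := by
  obtain ⟨i1, i2, i3, i4⟩ := I.inputStore_header
  have h1 : P 1 = I.n := (hP 1 (by omega)).trans i1
  have h2 : P 2 = I.m := (hP 2 (by omega)).trans i2
  have h3 : P 3 = (I.s : ℕ) := (hP 3 (by omega)).trans i3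
  have h4 : P 4 = (I.t : ℕ) := (hP 4 (by omega)).trans i4
  have hlo : (cond und 2 0 : ℤ) = 0 ∨ (cond und 2 0 : ℤ) = 2 := by cases und <;> simp
  have hnone : ∀ U : Arrays, paths (Traverses I.ends und) I.s I.t = ∅ →
      reportNone.run P 0 env U = T → ∃ y, IsAnswer (paths (Traverses I.ends und) I.s I.t)
        (paths (Traverses I.ends und) I.s I.t)
        (Matrix.diagonal I.a) I.c I.c y ∧ (encodeAnswer y).length ≤ I.encode.length ∧
      T 12 0 = (encodeAnswer y).length ∧ ∀ i : Fin (encodeAnswer y).length,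
        T 12 ((i : ℕ) + 1 : ℤ) = (encodeAnswer y).get i := by
    intro U hU hT
    have hT12 : T 12 = Function.update (Function.update (U 12) 0 1) 1 0 := by
      rw [← hT]
      simp only [reportNone, Cmd.run, Ex.eval, Arrays.set_same]
    refine ⟨none, .inl hU, ?_, ?_, fun i => ?_⟩
    · rw [I.length_encode]
      simp only [encodeAnswer, List.length_singleton]
      omega
    · rw [hT12]
      simp [encodeAnswer]
    · have hi : (i : ℕ) = 0 := by
        have := i.isLt
        simp only [encodeAnswer, List.length_singleton] at this
        omega
      rw [hT12, List.get_eq_getElem]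
      simp [encodeAnswer, hi]
  simp only [solve, Cmd.run, Ex.eval, h4] at hT
  obtain ⟨C, A, D, hD, hCD, hAD, a1, a2⟩ := run_readInstance I (env := env) (S := S) hP rfl
  generalize readInstance.run P 0 env S = S1 at *
  have hC : ∀ e, 0 ≤ C e := fun e => by
    have : (0 : ℚ) ≤ C e := by rw [hCD]; exact mul_nonneg (hc e) hD.le
    exact_mod_cast this
  have hA : ∀ e, 0 ≤ A e := fun e => by
    have : (0 : ℚ) ≤ A e := by rw [hAD]; exact mul_nonneg (ha e) hD.le
    exact_mod_cast this
  -- At flow zero the slopes are `-c` and `c`, and zero lies between them.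
  have hopt : IsOptimal I.ends (cond und 2 0) C A (fun _ => 0) S1 := by
    intro e
    rw [a2, a2]
    simp [IsTight, residualLength, hC e]
  have b := run_stage (env := env) h1 h2 h3 a1 hopt rfl
  generalize (stage (cond und 2 0)).run P 0 env S1 = S2 at *
  unfold ifPos at hT
  split_ifs at hT with hr1 hr2
  · obtain ⟨F, c1, c2, c3, c4⟩ := run_augment (env := env) h1 h2 h4 hC hA hlo b IsFlow.zero
      (fun e => by rcases hlo with h | h <;> rw [h] <;> norm_num) hr1 rfl
    generalize augment.run P 0 env S2 = S3 at *
    have d := run_stage (env := env) h1 h2 h3 c1 c2 rfl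
    generalize (stage (cond und 2 0)).run P 0 env S3 = S4 at *
    obtain ⟨G, e1, e2, e3, e4⟩ := run_augment (env := env) h1 h2 h4 hC hA hlo d c3
      (fun e => (c4 e).1) hr2 rfl
    generalize augment.run P 0 env S4 = S5 at *
    obtain ⟨E₁, hE₁, E₂, hE₂, f1, f2, f3, f4, f5⟩ := run_decompose (und := und) h1 h2 h3 h4 e1 e3
      (fun h e => by have := (e4 e).1.1; rw [h] at this; simpa using this) hT
    have hlen : (encodeAnswer (some (E₁, E₂))).length = 1 + 2 * I.m := by
      simp only [encodeAnswer, List.length_cons, List.length_append, length_indicatorWord]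
      ring
    refine ⟨some (E₁, E₂), ⟨hE₁, hE₂, fun T₁ hT₁ T₂ hT₂ => ?_⟩, ?_, ?_, fun i => ?_⟩
    · have := pairCost_le_of_isTight (ends := I.ends) (π := fun v => S5 7 (v : ℕ)) hC hA e3 (fun e => (e4 e).1) e2 f1
        hT₁ hT₂
      -- The comparison is made for the integral costs, which are `D` times the rational ones.
      refine le_of_mul_le_mul_right ?_ hD
      rw [← objective_diagonal I.a I.c A C hAD hCD, ← objective_diagonal I.a I.c A C hAD hCD]
      exact_mod_cast this
    · rw [hlen, I.length_encode]
      omega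
    · rw [f2, hlen]
      push_cast
      rfl
    · have hi := i.isLt.trans_eq hlen
      rw [List.get_eq_getElem]
      simp only [encodeAnswer, List.getElem_cons, List.getElem_append, length_indicatorWord]
      split_ifs with j1 j2
      · rw [j1]
        simpa using f3
      · have := f4 ⟨i - 1, j2⟩
        simp only [indicatorWord, List.getElem_map, List.getElem_finRange]
        rw [show ((i : ℕ) + 1 : ℤ) = 2 + ((i - 1 : ℕ) : ℤ) by omega]
        exact this
      · have := f5 ⟨i - 1 - I.m, by omega⟩
        simp only [indicatorWord, List.getElem_map, List.getElem_finRange]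
        rw [show ((i : ℕ) + 1 : ℤ) = 2 + I.m + ((i - 1 - I.m : ℕ) : ℤ) by omega]
        exact this
  · obtain ⟨F, c1, c2, c3, c4⟩ := run_augment (env := env) h1 h2 h4 hC hA hlo b IsFlow.zero
      (fun e => by rcases hlo with h | h <;> rw [h] <;> norm_num) hr1 rfl
    generalize augment.run P 0 env S2 = S3 at *
    have d := run_stage (env := env) h1 h2 h3 c1 c2 rfl
    generalize (stage (cond und 2 0)).run P 0 env S3 = S4 at *
    exact hnone _ (d.paths_eq_empty (fun e => by have := (c4 e).2; omega) hr2) hT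
  · exact hnone _ (b.paths_eq_empty (fun e => by simp) hr1) hT

/-- What remains is that `n` and `m`, which govern all loops, are at most the input length. This
holds because vertices and edges are listed explicitly. -/
theorem solvableInPolyTime_paths (und : Bool) :
    SolvableInPolyTime PathInstance.encode (fun _ => encodeAnswer)
      (fun I => IsAnswer (paths (Traverses I.ends und) I.s I.t)
        (paths (Traverses I.ends und) I.s I.t) (Matrix.diagonal I.a) I.c I.c)
      {I | 0 ≤ I.a ∧ 0 ≤ I.c} := by
  refine solvableInPolyTime_of_cmd (solve (cond und 2 0)) (fun I _ b => ?_)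
    fun I hI P S hP => run_solve I hI.1 hI.2 und hP rfl
  have h1 := length_le_inputLength I.encode
  rw [I.length_encode] at h1
  obtain ⟨i1, i2, -, -⟩ := I.inputStore_header
  cases b
  · rw [cond_false, i1]
    omega
  · rw [cond_true, i2]
    omega

end COPIC

theorem mainTheorem12 :
    -- undirected graphs
    RAM.SolvableInPolyTime
      COPIC.PathInstance.encode
      (fun _ => COPIC.encodeAnswer)
      (fun I => COPIC.IsAnswer
        (COPIC.paths I.link I.s I.t) (COPIC.paths I.link I.s I.t)
        (Matrix.diagonal I.a) I.c I.c)
      {I | 0 ≤ I.a ∧ 0 ≤ I.c} ∧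
    -- directed graphs
    RAM.SolvableInPolyTime
      COPIC.PathInstance.encode
      (fun _ => COPIC.encodeAnswer)
      (fun I => COPIC.IsAnswer
        (COPIC.paths I.diLink I.s I.t) (COPIC.paths I.diLink I.s I.t)
        (Matrix.diagonal I.a) I.c I.c)
      {I | 0 ≤ I.a ∧ 0 ≤ I.c} := by
  have h1 : ∀ I : COPIC.PathInstance, I.link = COPIC.Traverses I.ends true := by
    intro I
    funext e u v
    simp [COPIC.PathInstance.link, COPIC.Traverses]
  have h2 : ∀ I : COPIC.PathInstance, I.diLink = COPIC.Traverses I.ends false := by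
    intro I
    funext e u v
    simp [COPIC.PathInstance.diLink, COPIC.Traverses]
  simp only [h1, h2]
  exact ⟨COPIC.solvableInPolyTime_paths true, COPIC.solvableInPolyTime_paths false⟩
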